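/- A strict partition $\lambda=(\lambda_1>\lambda_2>\dots>\lambda_l>0)$ is a finite, possibly empty, strictly decreasing sequence of positive integers, of length $\ell(\lambda)=l$ and size $|\lambda|=\sum_i\lambda_i$; $\mathcal{SP}_n$ is the set of strict partitions of size $n$. Its shifted Young diagram is $S(\lambda)=\{(i,j)\in\mathbb{Z}^2 : 1\le i\le \ell(\lambda),\ i\le j\le \lambda_i+i-1\}$, and for a box $\square=(i,j)\in S(\lambda)$ put $c_\square=j-i$ and $\widehat{c}_\square=\tfrac12 c_\square(c_\square+1)$. For strict partitions $\lambda,\mu$ with $k=|\lambda|-|\mu|\ge 0$, let $g^{\lambda/\mu}$ be the number of sequences $(\lambda^{(0)},\dots,\lambda^{(k)})$ of strict partitions with $\lambda^{(0)}=\mu$ and $\lambda^{(k)}=\lambda$ such that each $S(\lambda^{(i)})$ is obtained from $S(\lambda^{(i-1)})$ by adding exactly one box; put $g^{\lambda/\mu}=0$ if $|\lambda|<|\mu|$. Thus $g^{\lambda/\mu}=0$ unless $S(\lambda)\supseteq S(\mu)$. Put $g^\lambda=g^{\lambda/\emptyset}$. A symmetric function $F$ is a family $F=(F_N)_{N\ge1}$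 of symmetric polynomials $F_N\in\mathbb{Q}[x_1,\dots,x_N]$, of bounded degree, with $F_{N+1}(x_1,\dots,x_N,0)=F_N(x_1,\dots,x_N)$ for all $N$. Write $F(\widehat{c}_\square:\square\in S(\lambda))$ for the value of $F$ when the first $|\lambda|$ variables are replaced by the $\widehat{c}_\square$, $\square\in S(\lambda)$, and all other variables by $0$. **Corollary.** Let $\mu$ be a strict partition of $m$. For any symmetric function $F$, the sum $$\sum_{\lambda\in\mathcal{SP}_{n+m}}\frac{m!}{(n+m)!}\,2^{\,n-\ell(\lambda)+\ell(\mu)}\,\frac{g^\lambda}{g^\mu}\,g^{\lambda/\mu}\,F(\widehat{c}_\square:\square\in S(\lambda))$$ is a polynomial function of $n$: there is a polynomial $P\in\mathbb{Q}[x]$, depending only on $\mu$ and $F$, such that the sum equals $P(n)$ for every integer $n\ge0$. -/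

import Mathlib

open scoped Nat Polynomial

noncomputable section

/-- A strict partition: a finite strictly decreasing sequence of positive integers
(possibly empty). -/
@[ext]
structure StrictPartition where
  parts : List ℕ
  strict : parts.Pairwise (· > ·)
  pos : ∀ a ∈ parts, 0 < a

namespace StrictPartition

/-- `ℓ(lam)`, the number of parts. -/
def length (lam : StrictPartition) : ℕ := lam.parts.length

/-- `|lam|`, the sum of the parts. -/
def size (lam : StrictPartition) : ℕ := lam.parts.sum

/-- The empty partition. -/
def empty : StrictPartition := ⟨[], List.Pairwise.nil, by simp⟩

theorem finite_size_eq (n : ℕ) : {lam : StrictPartition | lam.size = n}.Finite := by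
  let f : {lam : StrictPartition | lam.size = n} → n.Partition := fun lam =>
    ⟨(lam.1.parts : Multiset ℕ), fun {i} hi => lam.1.pos i (by simpa using hi),
      by simpa [size] using lam.2⟩
  have hf : Function.Injective f := by
    intro a b h
    have h1 : (a.1.parts : Multiset ℕ) = (b.1.parts : Multiset ℕ) :=
      congrArg Nat.Partition.parts h
    have h2 : a.1.parts.Perm b.1.parts := Multiset.coe_eq_coe.mp h1
    refine Subtype.ext (StrictPartition.ext ?_)
    exact h2.eq_of_pairwise (fun x y _ _ hxy hyx => absurd hxy (not_lt.mpr (le_of_lt hyx)))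
      a.1.strict b.1.strict
  exact Finite.of_injective f hf

/-- `SP_n`, the finite set of all strict partitions of `n`. -/
def ofSize (n : ℕ) : Finset StrictPartition := (finite_size_eq n).toFinset

/-- The shifted Young diagram
`S(lam) = {(i, j) ∈ ℤ² | 1 ≤ i ≤ ℓ(lam), i ≤ j ≤ lam_i + i - 1}`.
The list index `i` starts at `0`, so row `i + 1` has length `lam.parts.get i`. -/
def diagram (lam : StrictPartition) : Finset (ℤ × ℤ) :=
  Finset.univ.biUnion fun i : Fin lam.parts.length =>
    {((i : ℤ) + 1)} ×ˢ Finset.Icc ((i : ℤ) + 1) ((lam.parts.get i : ℤ) + ((i : ℤ) + 1) - 1)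

/-- `S(nu)` is obtained from `S(lam)` by adding exactly one box. -/
def AddsOneBox (lam nu : StrictPartition) : Prop :=
  ∃ b : ℤ × ℤ, b ∉ lam.diagram ∧ nu.diagram = insert b lam.diagram

/-- The standard tableaux of shape `S(lam/mu)`: sequences
`(lam⁽⁰⁾, …, lam⁽ᵏ⁾)` of strict partitions, `k = |lam| - |mu|`, from `mu` to `lam`,
adding exactly one box at each step. There are none unless `S(mu) ⊆ S(lam)`. -/
def StandardTableau (lam mu : StrictPartition) : Type :=
  {T : Fin (lam.size - mu.size + 1) → StrictPartition //
    T 0 = mu ∧ T (Fin.last _) = lam ∧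
      ∀ i : Fin (lam.size - mu.size), AddsOneBox (T i.castSucc) (T i.succ)}

/-- `g^{lam/mu}`, the number of standard tableaux of shape `S(lam/mu)`. -/
def numSkewTableaux (lam mu : StrictPartition) : ℕ := Nat.card (StandardTableau lam mu)

/-- `g^lam = g^{lam/∅}`. -/
def numTableaux (lam : StrictPartition) : ℕ := numSkewTableaux lam empty

end StrictPartition

/-- `ĉ_□ = c_□ (c_□ + 1) / 2`, where `c_□ = j - i` is the content of the box `□ = (i, j)`. -/
def contentHat (b : ℤ × ℤ) : ℚ := 1 / 2 * ((b.2 - b.1 : ℤ) : ℚ) * (((b.2 - b.1 : ℤ) : ℚ) + 1)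

/-- A symmetric function with rational coefficients: a family of symmetric polynomials
`F_N ∈ ℚ[x_1, …, x_N]` of bounded degree, with `F_{N+1}(x_1, …, x_N, 0) = F_N(x_1, …, x_N)`.
(Including `N = 0` changes nothing: `F_0` is the constant `F_1(0)`.) -/
structure SymmetricFunction where
  poly : (N : ℕ) → MvPolynomial (Fin N) ℚ
  symmetric : ∀ N, (poly N).IsSymmetric
  stable : ∀ N, MvPolynomial.aeval
    (Fin.snoc (α := fun _ => MvPolynomial (Fin N) ℚ) MvPolynomial.X 0) (poly (N + 1)) = poly N
  bounded : ∃ d : ℕ, ∀ N, (poly N).totalDegree ≤ d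

/-- `F(a_b : b ∈ s)`: the first `#s` variables of `F` are replaced by the values `a b`, `b ∈ s`
(in any order, as `F` is symmetric), all other variables by `0`; by stability this is the value
of `F_{#s}`. -/
def SymmetricFunction.evalOn (F : SymmetricFunction) {ι : Type*} (s : Finset ι) (a : ι → ℚ) : ℚ :=
  MvPolynomial.eval (fun k : Fin s.card => a (s.equivFin.symm k)) (F.poly s.card)

end

/-! Put w(λ) = 2^{-ℓ(λ)} g^λ / |λ|!, which is `planchWeight` by the product formula
`numTableaux_eq`. The sum becomes Σ_λ 2^n (w(λ)/w(μ)) g^{λ/μ} f(λ) with f(λ) = F(ĉ_□ : □ ∈ S(λ)).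
Since g^{λ/μ} counts paths, this is (Uⁿ f)(μ) for the operator (U f)(λ) = Σ_ν 2 (w(ν)/w(λ)) f(ν),
with ν running over λ plus one box (`upOp`, `pathSum_succ`). If U - 1 kills f after finitely many
applications, then Uⁿ f = Σ_k C(n,k) (U - 1)^k f is polynomial in n.

The nilpotency comes from a filtration. The function f is a polynomial in the power sums p_k = Σ_□
ĉ_□^k (`exists_evalOn_mem`); give p_k weight k + 1. Adding a box to a row of length a turns p_k into
p_k + chat(a)^k, so U - 1 applied to a product of power sums involves the moments M_j of chat(a)
under the transition weights of U. By `hookProd_up` these weights are Lagrange interpolation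
coefficients, whence Σ_j M_j t^j = Π_b (1 - chat(b-1) t) / (1 - chat(b) t), over the parts b
(`mk_upMoment_mul`). Newton's identities then express M_j through Σ_b (chat(b)^k - chat(b-1)^k),
which is a sum over boxes of a polynomial in ĉ of degree less than k. Hence M_0 = 1 and M_j has
weight at most j, so replacing p_k by chat(a)^k costs at least one unit of weight (`upOp_sub_mem`).

The product formula rests on a companion interpolation identity for removing boxes
(`sum_lower_hookProd`). -/

noncomputable section

/-! ### Part sets, rows and shifted diagrams -/

namespace StrictPartition

/-- The set of parts of a strict partition. -/
def partSet (lam : StrictPartition) : Finset ℕ := lam.parts.toFinset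

/-- The length of the `i`-th row (rows are counted from `0`), `0` beyond the last row. -/
def row (lam : StrictPartition) (i : ℕ) : ℕ := lam.parts.getD i 0

theorem nodup (lam : StrictPartition) : lam.parts.Nodup :=
  lam.strict.imp fun h => ne_of_gt h

theorem mem_partSet {lam : StrictPartition} {a : ℕ} : a ∈ lam.partSet ↔ a ∈ lam.parts := by
  simp [partSet]

theorem zero_notMem_partSet (lam : StrictPartition) : 0 ∉ lam.partSet := fun h =>
  absurd (lam.pos 0 (mem_partSet.mp h)) (lt_irrefl 0)

theorem pos_of_mem {lam : StrictPartition} {a : ℕ} (h : a ∈ lam.partSet) : 0 < a :=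
  lam.pos a (mem_partSet.mp h)

theorem partSet_injective : Function.Injective partSet := by
  intro a b h
  have h2 : a.parts.Perm b.parts := List.perm_of_nodup_nodup_toFinset_eq a.nodup b.nodup h
  refine StrictPartition.ext ?_
  exact h2.eq_of_pairwise (fun x y _ _ hxy hyx => absurd hxy (not_lt.mpr (le_of_lt hyx)))
    a.strict b.strict

theorem partSet_surjective {S : Finset ℕ} (hS : 0 ∉ S) : ∃ lam : StrictPartition, lam.partSet = S := by
  refine ⟨⟨S.sort (· ≥ ·), ?_, ?_⟩, ?_⟩
  · exact (Finset.sortedGT_sort S).pairwise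
  · intro a ha
    rw [Finset.mem_sort] at ha
    exact Nat.pos_of_ne_zero fun h => hS (h ▸ ha)
  · simp [partSet]

theorem size_eq_sum (lam : StrictPartition) : lam.size = ∑ a ∈ lam.partSet, a := by
  rw [partSet, List.sum_toFinset _ lam.nodup]; simp [size]

theorem length_eq_card (lam : StrictPartition) : lam.length = lam.partSet.card := by
  rw [partSet, List.toFinset_card_of_nodup lam.nodup]; rfl

theorem mem_ofSize {lam : StrictPartition} {n : ℕ} : lam ∈ ofSize n ↔ lam.size = n := by
  simp [ofSize]

theorem mem_partSet_iff_row {lam : StrictPartition} {a : ℕ} (ha : 0 < a) :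
    a ∈ lam.partSet ↔ ∃ i, lam.row i = a := by
  rw [mem_partSet]
  constructor
  · intro h
    obtain ⟨i, hi, rfl⟩ := List.getElem_of_mem h
    exact ⟨i, by simp [row, hi]⟩
  · rintro ⟨i, rfl⟩
    by_cases hi : i < lam.parts.length
    · simp [row, hi]
    · simp [row, hi] at ha

theorem row_lt_row {lam : StrictPartition} {i j : ℕ} (hij : i < j) (hi : 0 < lam.row i) :
    lam.row j < lam.row i := by
  by_cases hj : j < lam.parts.length
  · have h := List.pairwise_iff_getElem.mp lam.strict i j (hij.trans hj) hj hij
    simpa [row, hj, hij.trans hj] using h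
  · simpa [row, hj] using hi

theorem row_inj {lam : StrictPartition} {i j : ℕ} (h : lam.row i = lam.row j)
    (hi : 0 < lam.row i) : i = j := by
  rcases lt_trichotomy i j with hij | hij | hij
  · exact absurd h (row_lt_row hij hi).ne'
  · exact hij
  · exact absurd h (row_lt_row hij (h ▸ hi)).ne

theorem mem_diagram {lam : StrictPartition} {b : ℤ × ℤ} :
    b ∈ lam.diagram ↔ ∃ i c : ℕ, c < lam.row i ∧ b = ((i : ℤ) + 1, (i : ℤ) + 1 + c) := by
  obtain ⟨b1, b2⟩ := b
  simp only [diagram, Finset.mem_biUnion, Finset.mem_univ, true_and, Finset.mem_product,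
    Finset.mem_singleton, Finset.mem_Icc, Prod.mk.injEq]
  constructor
  · rintro ⟨i, h1, h2, h3⟩
    refine ⟨i, (b2 - (i + 1)).toNat, ?_, h1, by omega⟩
    have : lam.row i = lam.parts.get i := by simp [row]
    omega
  · rintro ⟨i, c, hc, h1, h2⟩
    have hi : i < lam.parts.length := by
      by_contra hi
      simp [row, hi] at hc
    have : lam.row i = lam.parts.get ⟨i, hi⟩ := by simp [row, hi]
    refine ⟨⟨i, hi⟩, h1, ?_, ?_⟩ <;> simp only [← this] <;> omega

theorem mk_mem_diagram {lam : StrictPartition} {i c : ℕ} :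
    (((i : ℤ) + 1, (i : ℤ) + 1 + c) : ℤ × ℤ) ∈ lam.diagram ↔ c < lam.row i := by
  rw [mem_diagram]
  constructor
  · rintro ⟨i', c', h, h'⟩
    simp only [Prod.mk.injEq] at h'
    obtain rfl : i = i' := by omega
    obtain rfl : c = c' := by omega
    exact h
  · exact fun h => ⟨i, c, h, rfl⟩

theorem addsOneBox_iff_row {lam nu : StrictPartition} :
    AddsOneBox lam nu ↔
      ∃ k, nu.row k = lam.row k + 1 ∧ ∀ i, i ≠ k → nu.row i = lam.row i := by
  constructor
  · rintro ⟨b, hb, h⟩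
    have hb' : b ∈ nu.diagram := by simp [h]
    obtain ⟨k, c0, hc0, rfl⟩ := mem_diagram.mp hb'
    rw [mk_mem_diagram] at hb
    have key : ∀ i c : ℕ, c < nu.row i ↔ (i = k ∧ c = c0) ∨ c < lam.row i := by
      intro i c
      rw [← mk_mem_diagram, h, Finset.mem_insert, mk_mem_diagram, Prod.mk.injEq]
      refine or_congr_left ⟨fun ⟨h1, h2⟩ => ?_, fun ⟨h1, h2⟩ => ?_⟩ <;> omega
    refine ⟨k, ?_, fun i hi => ?_⟩
    -- Rows are initial segments: testing `key` at the new box, at the old end and at the new last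
    -- box determines the new length.
    · have h1 := key k c0
      have h2 := key k (lam.row k)
      have h3 := key k (nu.row k - 1)
      omega
    · have h1 := key i (nu.row i)
      have h2 := key i (lam.row i)
      omega
  · rintro ⟨k, hk, h⟩
    refine ⟨((k : ℤ) + 1, (k : ℤ) + 1 + (lam.row k : ℕ)), by rw [mk_mem_diagram]; omega, ?_⟩
    ext b
    rw [Finset.mem_insert, mem_diagram, mem_diagram]
    constructor
    · rintro ⟨i, c, hc, rfl⟩
      by_cases hi : i = k
      · subst hi
        by_cases hc' : c = lam.row i
        · left; rw [hc']
        · right; exact ⟨i, c, by omega, rfl⟩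
      · right; exact ⟨i, c, by rwa [← h i hi], rfl⟩
    · rintro (rfl | ⟨i, c, hc, rfl⟩)
      · exact ⟨k, _, by omega, rfl⟩
      · refine ⟨i, c, ?_, rfl⟩
        by_cases hi : i = k
        · subst hi; omega
        · rwa [h i hi]

/-- Passing to part sets forgets the row indices: a part `a` becomes `a + 1`, and the fictitious
part `0` stands for opening a new row. -/
theorem AddsOneBox.exists_part {lam nu : StrictPartition} (h : AddsOneBox lam nu) :
    ∃ a ∈ insert 0 lam.partSet, a + 1 ∉ lam.partSet ∧
      nu.partSet = insert (a + 1) (lam.partSet.erase a) := by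
  obtain ⟨k, hk, h⟩ := addsOneBox_iff_row.mp h
  refine ⟨lam.row k, ?_, ?_, ?_⟩
  · rcases Nat.eq_zero_or_pos (lam.row k) with h0 | h0
    · simp [h0]
    · exact Finset.mem_insert_of_mem ((mem_partSet_iff_row h0).mpr ⟨k, rfl⟩)
  · intro hm
    obtain ⟨i, hi⟩ := (mem_partSet_iff_row (Nat.succ_pos _)).mp hm
    have hik : i ≠ k := by rintro rfl; omega
    exact hik (row_inj (lam := nu) (by rw [h i hik, hi, hk]) (by rw [h i hik, hi]; omega))
  · ext b
    rcases Nat.eq_zero_or_pos b with rfl | hb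
    · simp [zero_notMem_partSet]
    · rw [mem_partSet_iff_row hb, Finset.mem_insert, Finset.mem_erase, mem_partSet_iff_row hb]
      constructor
      · rintro ⟨i, rfl⟩
        by_cases hi : i = k
        · left; rw [hi, hk]
        · right
          rw [h i hi] at hb ⊢
          exact ⟨fun e => hi (row_inj e hb), i, rfl⟩
      · rintro (rfl | ⟨h1, i, rfl⟩)
        · exact ⟨k, hk⟩
        · exact ⟨i, h i (by rintro rfl; exact h1 rfl)⟩

theorem addsOneBox_of_part {lam nu : StrictPartition} {a : ℕ} (ha : a ∈ insert 0 lam.partSet)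
    (ha1 : a + 1 ∉ lam.partSet) (hnu : nu.partSet = insert (a + 1) (lam.partSet.erase a)) :
    AddsOneBox lam nu := by
  -- A partition is determined by its part set, so it is enough to build one `nu'` explicitly, as a
  -- list.
  suffices ∃ nu' : StrictPartition, AddsOneBox lam nu' ∧
      nu'.partSet = insert (a + 1) (lam.partSet.erase a) by
    obtain ⟨nu', h1, h2⟩ := this
    rwa [partSet_injective (hnu.trans h2.symm)]
  suffices ∃ (nu' : StrictPartition) (k : ℕ), lam.row k = a ∧ nu'.row k = a + 1 ∧
      ∀ i, i ≠ k → nu'.row i = lam.row i by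
    obtain ⟨nu', k, hk, hk', h⟩ := this
    have hadd : AddsOneBox lam nu' := addsOneBox_iff_row.mpr ⟨k, by rw [hk, hk'], h⟩
    refine ⟨nu', hadd, ?_⟩
    obtain ⟨a', ha', hb', hc'⟩ := hadd.exists_part
    suffices a' = a by rw [hc', this]
    have h1 : a + 1 ∈ nu'.partSet := (mem_partSet_iff_row (Nat.succ_pos _)).mpr ⟨k, hk'⟩
    rw [hc', Finset.mem_insert] at h1
    rcases h1 with h1 | h1
    · omega
    · exact absurd (Finset.mem_of_mem_erase h1) ha1
  rcases Finset.mem_insert.mp ha with rfl | ha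
  · refine ⟨⟨lam.parts ++ [1], ?_, ?_⟩, lam.parts.length, by simp [row], by simp [row], ?_⟩
    · rw [List.pairwise_append]
      refine ⟨lam.strict, List.pairwise_singleton _ _, fun b hb c hc => ?_⟩
      rw [List.mem_singleton] at hc
      have h1 := lam.pos b hb
      have h2 : b ≠ 1 := fun e => ha1 (mem_partSet.mpr (by simpa [e] using hb))
      omega
    · intro b hb
      rw [List.mem_append, List.mem_singleton] at hb
      rcases hb with hb | rfl
      · exact lam.pos b hb
      · exact one_pos
    · intro i hi
      rcases lt_or_gt_of_ne hi with h | h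
      · simp [row, h, Nat.lt_succ_of_lt h]
      · have h1 : ¬ i < lam.parts.length := by omega
        have h2 : ¬ i < lam.parts.length + 1 := by omega
        simp [row, h1, h2]
  · obtain ⟨k, hk⟩ := (mem_partSet_iff_row (pos_of_mem ha)).mp ha
    have hkl : k < lam.parts.length := by
      by_contra h
      have h0 := pos_of_mem ha
      simp [row, h] at hk
      omega
    have hk2 : lam.parts[k] = a := by simpa [row, hkl] using hk
    refine ⟨⟨lam.parts.set k (a + 1), ?_, ?_⟩, k, hk, by simp [row, hkl], ?_⟩
    · rw [List.pairwise_iff_getElem]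
      intro i j hi hj hij
      rw [List.length_set] at hi hj
      have hs := List.pairwise_iff_getElem.mp lam.strict i j hi hj hij
      have hne : lam.parts[i] ≠ a + 1 := fun e =>
        ha1 (mem_partSet.mpr (e ▸ List.getElem_mem hi))
      rw [List.getElem_set, List.getElem_set]
      split_ifs with h1 h2 h2
      · omega
      · subst h1; omega
      · subst h2; omega
      · exact hs
    · intro b hb
      rcases List.mem_or_eq_of_mem_set hb with hb | rfl
      · exact lam.pos b hb
      · exact Nat.succ_pos _
    · intro i hi
      simp [row, hi.symm]

theorem sum_diagram (lam : StrictPartition) (f : ℤ → ℚ) :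
    ∑ b ∈ lam.diagram, f (b.2 - b.1) = ∑ a ∈ lam.partSet, ∑ c ∈ Finset.range a, f c := by
  rw [partSet, List.sum_toFinset _ lam.nodup, ← Fin.sum_univ_fun_getElem, Finset.sum_sigma']
  symm
  refine Finset.sum_bij (fun p _ => (((p.1 : ℕ) : ℤ) + 1, ((p.1 : ℕ) : ℤ) + 1 + (p.2 : ℕ))) ?_ ?_ ?_ ?_
  · rintro ⟨i, c⟩ h
    simpa [mk_mem_diagram, row] using h
  · rintro ⟨i, c⟩ _ ⟨i', c'⟩ _ h
    simp only [Prod.mk.injEq] at h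
    obtain rfl : i = i' := Fin.ext (by omega)
    obtain rfl : c = c' := by omega
    rfl
  · intro b hb
    obtain ⟨i, c, hc, rfl⟩ := mem_diagram.mp hb
    have hi : i < lam.parts.length := by
      by_contra hi
      simp [row, hi] at hc
    exact ⟨⟨⟨i, hi⟩, c⟩, by simpa [row, hi] using hc, rfl⟩
  · rintro ⟨i, c⟩ _
    simp

end StrictPartition

/-! ### Counting box-adding paths -/

namespace StrictPartition

/-- Sequences of `k + 1` strict partitions from `mu` to `lam` adding one box at each step. -/
abbrev BoxPath (k : ℕ) (mu lam : StrictPartition) : Type :=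
  {T : Fin (k + 1) → StrictPartition //
    T 0 = mu ∧ T (Fin.last _) = lam ∧ ∀ i : Fin k, AddsOneBox (T i.castSucc) (T i.succ)}

theorem AddsOneBox.size_eq {lam nu : StrictPartition} (h : AddsOneBox lam nu) :
    nu.size = lam.size + 1 := by
  obtain ⟨a, ha, ha1, hnu⟩ := h.exists_part
  rw [size_eq_sum, size_eq_sum, hnu, Finset.sum_insert (fun h => ha1 (Finset.mem_of_mem_erase h))]
  rcases Finset.mem_insert.mp ha with rfl | ha
  · rw [Finset.erase_eq_of_notMem lam.zero_notMem_partSet]; omega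
  · rw [← Finset.sum_erase_add _ _ ha]; omega

/-- The strict partitions obtained by removing a box. -/
def lower (lam : StrictPartition) : Finset StrictPartition :=
  @Finset.filter _ (fun nu => AddsOneBox nu lam) (Classical.decPred _) (ofSize (lam.size - 1))

/-- The strict partitions obtained by adding a box. -/
def upper (lam : StrictPartition) : Finset StrictPartition :=
  @Finset.filter _ (fun nu => AddsOneBox lam nu) (Classical.decPred _) (ofSize (lam.size + 1))

theorem mem_lower {lam nu : StrictPartition} : nu ∈ lam.lower ↔ AddsOneBox nu lam := by
  rw [lower, @Finset.mem_filter _ _ (Classical.decPred _), mem_ofSize, and_iff_right_iff_imp]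
  intro h
  rw [h.size_eq, Nat.add_sub_cancel]

theorem mem_upper {lam nu : StrictPartition} : nu ∈ lam.upper ↔ AddsOneBox lam nu := by
  rw [upper, @Finset.mem_filter _ _ (Classical.decPred _), mem_ofSize, and_iff_right_iff_imp]
  exact fun h => h.size_eq

/-- A path ends with a path to a partition with one box less. -/
def boxPathSucc (k : ℕ) (mu lam : StrictPartition) :
    BoxPath (k + 1) mu lam ≃ Σ nu : {nu // nu ∈ lam.lower}, BoxPath k mu nu.1 where
  toFun T := ⟨⟨T.1 (Fin.last k).castSucc, mem_lower.mpr (by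
      have := T.2.2.2 (Fin.last k)
      rwa [Fin.succ_last, T.2.2.1] at this)⟩,
    ⟨fun i => T.1 i.castSucc, T.2.1, rfl, fun i => T.2.2.2 i.castSucc⟩⟩
  invFun p := ⟨Fin.snoc (α := fun _ => StrictPartition) p.2.1 lam, by
      exact (Fin.snoc_castSucc (α := fun _ => StrictPartition) lam p.2.1 0).trans p.2.2.1, by simp, by
      intro i
      refine Fin.lastCases ?_ (fun i => ?_) i
      · rw [Fin.snoc_castSucc, Fin.succ_last, Fin.snoc_last, p.2.2.2.1]
        exact mem_lower.mp p.1.2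
      · rw [Fin.snoc_castSucc, Fin.succ_castSucc, Fin.snoc_castSucc]
        exact p.2.2.2.2 i⟩
  left_inv T := by
    refine Subtype.ext (funext fun i => ?_)
    refine Fin.lastCases ?_ (fun i => ?_) i
    · simp [T.2.2.1]
    · simp
  right_inv p := by
    obtain ⟨⟨nu, hnu⟩, ⟨T, h0, h1, h2'⟩⟩ := p
    simp only at h1
    subst h1
    have key : (fun i : Fin (k + 1) =>
        Fin.snoc (α := fun _ => StrictPartition) T lam i.castSucc) = T := by simp
    -- Generalizing the restricted path to `T'` lets the equality `key` be substituted inside the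
    -- dependent pair.
    suffices ∀ T' (hT : T' = T) (h1 : T' (Fin.last k) ∈ lam.lower) (h2),
        (⟨⟨T' (Fin.last k), h1⟩, ⟨T', h2⟩⟩ : Σ nu : {nu // nu ∈ lam.lower}, BoxPath k mu nu.1) =
          ⟨⟨T (Fin.last k), hnu⟩, ⟨T, h0, rfl, h2'⟩⟩ from this _ key _ _
    rintro _ rfl _ _
    rfl

theorem finite_boxPath (k : ℕ) (mu lam : StrictPartition) : Finite (BoxPath k mu lam) := by
  induction k generalizing lam with
  | zero =>
    have : Subsingleton (BoxPath 0 mu lam) := ⟨fun T T' => Subtype.ext (funext fun i => by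
      rw [Fin.fin_one_eq_zero i]; exact T.2.1.trans T'.2.1.symm)⟩
    infer_instance
  | succ k ih =>
    have := fun nu => ih nu
    exact Finite.of_equiv _ (boxPathSucc k mu lam).symm

theorem card_boxPath_succ (k : ℕ) (mu lam : StrictPartition) :
    Nat.card (BoxPath (k + 1) mu lam) = ∑ nu ∈ lam.lower, Nat.card (BoxPath k mu nu) := by
  have := fun nu => finite_boxPath k mu nu
  rw [Nat.card_congr (boxPathSucc k mu lam), Nat.card_sigma,
    Finset.sum_coe_sort lam.lower (fun nu => Nat.card (BoxPath k mu nu))]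

theorem card_boxPath_zero (mu : StrictPartition) : Nat.card (BoxPath 0 mu mu) = 1 := by
  rw [Nat.card_eq_one_iff_unique]
  exact ⟨⟨fun T T' => Subtype.ext (funext fun i => by
      rw [Fin.fin_one_eq_zero i]; exact T.2.1.trans T'.2.1.symm)⟩, ⟨⟨fun _ => mu, rfl, rfl, fun i => i.elim0⟩⟩⟩

theorem card_boxPath_zero_of_ne {mu lam : StrictPartition} (h : lam ≠ mu) :
    Nat.card (BoxPath 0 mu lam) = 0 := by
  have : IsEmpty (BoxPath 0 mu lam) := ⟨fun T => h (T.2.2.1.symm.trans T.2.1)⟩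
  exact Nat.card_of_isEmpty

theorem numSkewTableaux_eq {lam mu : StrictPartition} {k : ℕ} (h : lam.size = k + mu.size) :
    lam.numSkewTableaux mu = Nat.card (BoxPath k mu lam) := by
  obtain rfl : k = lam.size - mu.size := by omega
  rfl

end StrictPartition

/-! ### The product formula and its ratios under adding or removing a box -/

/-- `a (a + 1) / 2`, the modified content of the box added to a row of length `a`. -/
def chat (a : ℚ) : ℚ := a * (a + 1) / 2

/-- The factor of a pair of parts in the product formula for shifted standard tableaux. -/
def pairFactor (a b : ℕ) : ℚ := |(a : ℚ) - b| / (a + b)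

/-- The product formula for `g^λ / |λ|!` in terms of the set of parts. -/
def hookProd (S : Finset ℕ) : ℚ :=
  (∏ a ∈ S, ((a ! : ℕ) : ℚ)⁻¹) * ∏ a ∈ S, ∏ b ∈ S with b < a, pairFactor a b

theorem pairFactor_comm (a b : ℕ) : pairFactor a b = pairFactor b a := by
  rw [pairFactor, pairFactor, abs_sub_comm, add_comm]

theorem pairFactor_self (a : ℕ) : pairFactor a a = 0 := by simp [pairFactor]

theorem pairFactor_pos {a b : ℕ} (h : a ≠ b) : 0 < pairFactor a b := by
  rw [pairFactor]
  have : (a : ℚ) - b ≠ 0 := sub_ne_zero.mpr (by exact_mod_cast h)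
  have h2 : 0 < a + b := by omega
  have : (0 : ℚ) < a + b := by exact_mod_cast h2
  positivity

theorem hookProd_pos (S : Finset ℕ) : 0 < hookProd S := by
  refine mul_pos (Finset.prod_pos fun a _ => by positivity) (Finset.prod_pos fun a _ =>
    Finset.prod_pos fun b hb => pairFactor_pos ?_)
  exact (Finset.mem_filter.mp hb).2.ne'

theorem hookProd_insert {R : Finset ℕ} {c : ℕ} (hc : c ∉ R) :
    hookProd (insert c R) = ((c ! : ℕ) : ℚ)⁻¹ * (∏ b ∈ R, pairFactor c b) * hookProd R := by
  have h1 : ∏ a ∈ R, ∏ b ∈ insert c R with b < a, pairFactor a b =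
      (∏ a ∈ R with ¬ a < c, pairFactor c a) * ∏ a ∈ R, ∏ b ∈ R with b < a, pairFactor a b := by
    rw [Finset.prod_filter, ← Finset.prod_mul_distrib]
    refine Finset.prod_congr rfl fun a ha => ?_
    have hac : a ≠ c := fun e => hc (e ▸ ha)
    rw [Finset.filter_insert]
    split_ifs with h h' h'
    · omega
    · rw [Finset.prod_insert (by simp [hc]), pairFactor_comm]
    · rw [one_mul]
    · omega
  have h2 : ({b ∈ insert c R | b < c} : Finset ℕ) = {b ∈ R | b < c} := by
    rw [Finset.filter_insert, if_neg (lt_irrefl c)]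
  rw [hookProd, hookProd, Finset.prod_insert hc, Finset.prod_insert hc, h1, h2,
    ← Finset.prod_filter_mul_prod_filter_not R (· < c) (pairFactor c)]
  ring

theorem hookProd_insert_zero {R : Finset ℕ} (h : 0 ∉ R) : hookProd (insert 0 R) = hookProd R := by
  rw [hookProd_insert h, Finset.prod_eq_one, Nat.factorial_zero]
  · simp
  · intro b hb
    have : (b : ℚ) ≠ 0 := by
      rintro e
      exact h ((Nat.cast_eq_zero.mp e) ▸ hb)
    simp [pairFactor, this]

theorem chat_sub_chat (a b : ℚ) : chat a - chat b = (a - b) * (a + b + 1) / 2 := by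
  unfold chat; ring

theorem chat_zero : chat 0 = 0 := by simp [chat]

theorem chat_inj {a b : ℕ} (h : chat a = chat b) : a = b := by
  rw [← sub_eq_zero, chat_sub_chat] at h
  have : (a : ℚ) + b + 1 ≠ 0 := by positivity
  have h1 : (a : ℚ) - b = 0 := by simpa [this] using h
  exact_mod_cast sub_eq_zero.mp h1

theorem chat_sub_one_inj {a b : ℕ} (ha : 0 < a) (hb : 0 < b) (h : chat (a - 1) = chat (b - 1)) :
    a = b := by
  obtain ⟨a, rfl⟩ := Nat.exists_eq_add_of_lt ha
  obtain ⟨b, rfl⟩ := Nat.exists_eq_add_of_lt hb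
  have := chat_inj (a := a) (b := b) (by simpa using h)
  omega

/-- For integers with a ≠ b, the numbers a + 1 - b and a - b never have opposite signs, so the
absolute values can be dropped from the ratio. -/
theorem abs_div_abs_succ {a b : ℕ} (h : a ≠ b) :
    |((a + 1 : ℕ) : ℚ) - b| / |(a : ℚ) - b| = ((a : ℚ) + 1 - b) / (a - b) := by
  rw [← abs_div, abs_of_nonneg]
  · push_cast; rfl
  · rcases lt_or_gt_of_ne h with h | h
    · have : (a : ℚ) + 1 ≤ b := by exact_mod_cast h
      exact div_nonneg_of_nonpos (by push_cast; linarith) (by linarith)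
    · have : (b : ℚ) + 1 ≤ a := by exact_mod_cast h
      exact div_nonneg (by push_cast; linarith) (by linarith)

/-- Here 2(chat a - chat(b-1)) = (a-b+1)(a+b) and 2(chat a - chat b) = (a-b)(a+b+1). The ratio thus
becomes rational in the values of `chat`, as interpolation requires. -/
theorem pairFactor_succ_div {a b : ℕ} (h : a ≠ b) :
    pairFactor (a + 1) b / pairFactor a b =
      (chat a - chat (b - 1)) / (chat a - chat b) := by
  have h1 : (a : ℚ) - b ≠ 0 := sub_ne_zero.mpr (by exact_mod_cast h)
  have h2 : (a : ℚ) + b + 1 ≠ 0 := by positivity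
  rw [pairFactor, pairFactor, div_div_div_comm, abs_div_abs_succ h, chat_sub_chat, chat_sub_chat,
    div_div_div_eq]
  have h3 : 0 < a + b := by omega
  have h3 : (a : ℚ) + b ≠ 0 := by exact_mod_cast h3.ne'
  push_cast
  have h4 : (a : ℚ) + 1 + b ≠ 0 := by positivity
  field_simp
  ring

theorem pairFactor_div_succ {a b : ℕ} (h : a + 1 ≠ b) (h' : 0 < a ∨ 0 < b) :
    pairFactor a b / pairFactor (a + 1) b =
      (chat a - chat b) / (chat a - chat (b - 1)) := by
  by_cases hab : a = b
  · subst hab; simp [pairFactor_self]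
  · rw [← inv_div, pairFactor_succ_div hab, inv_div]

/-- The transition weight from the strict partition with set of parts `S` for a box added to a
row of length `a`. -/
def upWeight (S : Finset ℕ) (a : ℕ) : ℚ :=
  (∏ b ∈ S, (chat a - chat (b - 1))) / ∏ b ∈ (insert 0 S).erase a, (chat a - chat b)

theorem upWeight_eq_zero {S : Finset ℕ} {a : ℕ} (h : a + 1 ∈ S) : upWeight S a = 0 := by
  rw [upWeight, Finset.prod_eq_zero h (by simp), zero_div]

/-- Identifies 2 w(ν)/w(λ) with `upWeight`. For a new row (a = 0) the factor 2 is absorbed by the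
extra part. For a > 0, the numerator factor chat a - chat(a-1) = a over the denominator factor chat
a - chat 0 = a(a+1)/2 gives 2/(a+1) = 2 a!/(a+1)!. -/
theorem hookProd_up {S : Finset ℕ} (h0 : 0 ∉ S) {a : ℕ} (ha : a ∈ insert 0 S) (ha1 : a + 1 ∉ S) :
    2 * ((2 : ℚ)⁻¹ ^ (insert (a + 1) (S.erase a)).card * hookProd (insert (a + 1) (S.erase a))) =
      upWeight S a * ((2 : ℚ)⁻¹ ^ S.card * hookProd S) := by
  rcases Nat.eq_zero_or_pos a with rfl | hapos
  · rw [Finset.erase_eq_of_notMem h0, Finset.card_insert_of_notMem ha1, hookProd_insert ha1,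
      upWeight, Finset.erase_insert h0, ← Finset.prod_div_distrib]
    have : ∏ b ∈ S, pairFactor (0 + 1) b =
        ∏ b ∈ S, (chat (0 : ℕ) - chat (b - 1)) / (chat (0 : ℕ) - chat b) := by
      refine Finset.prod_congr rfl fun b hb => ?_
      have hb0 : 0 ≠ b := fun e => h0 (e ▸ hb)
      rw [← pairFactor_succ_div hb0]
      have : (b : ℚ) ≠ 0 := by exact_mod_cast hb0.symm
      simp [pairFactor, this]
    rw [this]
    simp [pow_succ]
    ring
  · have haS : a ∈ S := by simpa [hapos.ne'] using ha
    obtain ⟨R, haR, rfl⟩ : ∃ R, a ∉ R ∧ S = insert a R :=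
      ⟨S.erase a, by simp, by simp [haS]⟩
    rw [Finset.erase_insert haR]
    have ha1R : a + 1 ∉ R := fun h => ha1 (Finset.mem_insert_of_mem h)
    have h0R : 0 ∉ R := fun h => h0 (Finset.mem_insert_of_mem h)
    rw [Finset.card_insert_of_notMem haR, Finset.card_insert_of_notMem ha1R,
      hookProd_insert ha1R, hookProd_insert haR, upWeight, Finset.prod_insert haR,
      Finset.erase_insert_of_ne hapos.ne, Finset.erase_insert haR, Finset.prod_insert h0R]
    have key : ∏ b ∈ R, pairFactor (a + 1) b = (∏ b ∈ R, pairFactor a b) *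
        ((∏ b ∈ R, (chat a - chat (b - 1))) / ∏ b ∈ R, (chat a - chat b)) := by
      rw [← Finset.prod_div_distrib, ← Finset.prod_mul_distrib]
      refine Finset.prod_congr rfl fun b hb => ?_
      have hab : a ≠ b := fun e => haR (e ▸ hb)
      rw [← pairFactor_succ_div hab, mul_div_cancel₀ _ (pairFactor_pos hab).ne']
    rw [key, Nat.factorial_succ, Nat.cast_zero, chat_sub_chat, chat_sub_chat]
    push_cast
    have : (a : ℚ) ≠ 0 := by exact_mod_cast hapos.ne'
    have : (a : ℚ) + 1 ≠ 0 := by positivity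
    have : ((a ! : ℕ) : ℚ) ≠ 0 := by positivity
    rw [mul_div_mul_comm]
    generalize (∏ b ∈ R, (chat a - chat (b - 1))) / ∏ b ∈ R, (chat a - chat b) = Q
    field_simp
    ring

/-- The weight of removing the last box of the row of length `c`. -/
def downWeight (S : Finset ℕ) (c : ℕ) : ℚ :=
  -(∏ b ∈ S, (chat (c - 1) - chat b)) / ∏ b ∈ S.erase c, (chat (c - 1) - chat (b - 1))

theorem downWeight_eq_zero {S : Finset ℕ} {a : ℕ} (h : a ∈ S) : downWeight S (a + 1) = 0 := by
  rw [downWeight, Finset.prod_eq_zero h (by simp), neg_zero, zero_div]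

/-- The factor of `downWeight` at the removed part is -(chat a - chat(a+1)) = a + 1, the quotient of
the factorials; the other parts contribute the ratios of `pairFactor_div_succ`. -/
theorem hookProd_down {R : Finset ℕ} {a : ℕ} (h0 : 0 ∉ R) (ha1 : a + 1 ∉ R) (ha : a ∉ R) :
    hookProd (insert a R) = downWeight (insert (a + 1) R) (a + 1) * hookProd (insert (a + 1) R) := by
  rw [hookProd_insert ha, hookProd_insert ha1, downWeight, Finset.erase_insert ha1,
    Finset.prod_insert ha1, Nat.factorial_succ]
  have key : ∏ b ∈ R, pairFactor a b = (∏ b ∈ R, pairFactor (a + 1) b) *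
      ((∏ b ∈ R, (chat a - chat b)) / ∏ b ∈ R, (chat a - chat (b - 1))) := by
    rw [← Finset.prod_div_distrib, ← Finset.prod_mul_distrib]
    refine Finset.prod_congr rfl fun b hb => ?_
    have hab : a + 1 ≠ b := fun e => ha1 (e ▸ hb)
    have hb0 : b ≠ 0 := fun e => h0 (e ▸ hb)
    rw [← pairFactor_div_succ hab (by omega), mul_div_cancel₀ _ (pairFactor_pos hab).ne']
  rw [key]
  push_cast
  rw [add_sub_cancel_right, ← neg_mul, mul_div_assoc, chat_sub_chat]
  generalize (∏ b ∈ R, (chat a - chat b)) / ∏ b ∈ R, (chat a - chat (b - 1)) = Q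
  have : (a : ℚ) + 1 ≠ 0 := by positivity
  have : ((a ! : ℕ) : ℚ) ≠ 0 := by positivity
  field_simp
  ring

/-! ### Two Lagrange interpolation identities -/

section Interpolation

variable {ι : Type*} [DecidableEq ι]

open Polynomial in
-- The difference Π(X - x_j) - Π(X - y_j) has degree below |s|, so it is interpolated at the nodes
-- y, where the second product vanishes. Compare the coefficients of X^{|s|-1}.
theorem sum_prod_sub_div_prod_sub (s : Finset ι) (x y : ι → ℚ) (hy : Set.InjOn y s) :
    ∑ i ∈ s, (∏ j ∈ s, (y i - x j)) / ∏ j ∈ s.erase i, (y i - y j) =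
      ∑ i ∈ s, y i - ∑ i ∈ s, x i := by
  rcases s.eq_empty_or_nonempty with rfl | hs
  · simp
  have hdeg : ∀ z : ι → ℚ, (∏ i ∈ s, (X - C (z i))).degree = (s.card : WithBot ℕ) := fun z => by
    rw [degree_prod]; simp
  have hlt : (∏ i ∈ s, (X - C (x i)) - ∏ i ∈ s, (X - C (y i))).degree < (s.card : WithBot ℕ) := by
    rw [← hdeg x]
    refine degree_sub_lt_left ((hdeg x).trans (hdeg y).symm) ?_ ?_
    · exact (monic_prod_X_sub_C x s).ne_zero
    · rw [(monic_prod_X_sub_C x s).leadingCoeff, (monic_prod_X_sub_C y s).leadingCoeff]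
  have h := Lagrange.coeff_eq_sum hy hlt
  rw [coeff_sub, prod_X_sub_C_coeff_card_pred s x hs.card_pos,
    prod_X_sub_C_coeff_card_pred s y hs.card_pos] at h
  rw [sub_eq_neg_add _ (∑ i ∈ s, x i), ← sub_neg_eq_add, h]
  refine Finset.sum_congr rfl fun i hi => ?_
  rw [eval_sub, eval_prod, eval_prod, Finset.prod_eq_zero (f := fun j => eval (y i) (X - C (y j))) hi
    (by simp)]
  simp

open Polynomial in
-- Interpolate Π(X - y_j), of degree |s|, at the |s| + 1 nodes x, then reverse the polynomials: put
-- X = 1/u and multiply by u^{|s|}.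
theorem sum_interpolation_reverse (s : Finset ι) (t : Finset ι) (x y : ι → ℚ) (hx : Set.InjOn x t)
    (hcard : t.card = s.card + 1) :
    ∑ i ∈ t, C ((∏ j ∈ s, (x i - y j)) / ∏ j ∈ t.erase i, (x i - x j)) *
      ∏ j ∈ t.erase i, (1 - C (x j) * X) = ∏ j ∈ s, (1 - C (y j) * X) := by
  have hdeg : (∏ j ∈ s, (X - C (y j))).degree < (t.card : WithBot ℕ) := by
    rw [degree_prod, hcard]
    simp only [degree_X_sub_C, Finset.sum_const, nsmul_eq_mul, mul_one]
    exact_mod_cast Nat.lt_succ_self _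
  have h := Lagrange.eq_interpolate hx hdeg
  rw [Lagrange.interpolate_eq_sum] at h
  have hrev : ∀ (r : Finset ι) (z : ι → ℚ) (u : ℚ), u ≠ 0 →
      ∏ j ∈ r, (1 - z j * u) = u ^ r.card * ∏ j ∈ r, (u⁻¹ - z j) := by
    intro r z u hu
    rw [← Finset.prod_const, ← Finset.prod_mul_distrib]
    refine Finset.prod_congr rfl fun j _ => ?_
    field_simp
  -- The substitution 1/u needs u ≠ 0; the positive rationals supply infinitely many points.
  refine eq_of_infinite_eval_eq _ _ ((Set.Ioi_infinite (0 : ℚ)).mono fun u hu => ?_)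
  have hu0 : u ≠ 0 := ne_of_gt hu
  have h' := congrArg (eval u⁻¹) h
  simp only [eval_finsetSum, eval_prod, eval_mul, eval_sub, eval_X, eval_C] at h'
  simp only [Set.mem_ofPred_eq, eval_finsetSum, eval_prod, eval_mul, eval_sub, eval_X, eval_C,
    eval_one]
  rw [hrev s y u hu0, h', Finset.mul_sum]
  refine Finset.sum_congr rfl fun i hi => ?_
  rw [hrev _ x u hu0, Finset.card_erase_of_mem hi, hcard, Nat.add_sub_cancel]
  ring

end Interpolation

/-! ### Newton's identities by logarithmic derivatives -/

section Newton

open PowerSeries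

theorem mk_pow_mul_one_sub (c : ℚ) :
    PowerSeries.mk (fun k => c ^ k) * (1 - C c * X) = 1 := by
  ext k
  rw [mul_sub, mul_one, ← mul_assoc, map_sub, mul_comm _ (C c)]
  cases k with
  | zero => simp
  | succ k => rw [coeff_succ_mul_X]; simp [coeff_one, pow_succ, mul_comm]

theorem derivative_prod_one_sub {ι : Type*} (s : Finset ι) (x : ι → ℚ) :
    d⁄dX ℚ (∏ i ∈ s, (1 - C (x i) * X)) =
      -(∏ i ∈ s, (1 - C (x i) * X)) * PowerSeries.mk (fun k => ∑ i ∈ s, x i ^ (k + 1)) := by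
  classical
  induction s using Finset.induction_on with
  | empty =>
    have : (PowerSeries.mk fun _ => (0 : ℚ)) = 0 := by ext; simp
    simp [this]
  | insert a s ha ih =>
    have h1 : (PowerSeries.mk fun k => ∑ i ∈ insert a s, x i ^ (k + 1)) =
        C (x a) * PowerSeries.mk (fun k => x a ^ k) +
          PowerSeries.mk (fun k => ∑ i ∈ s, x i ^ (k + 1)) := by
      ext k
      simp [Finset.sum_insert ha, pow_succ, mul_comm]
    have h2 : d⁄dX ℚ (1 - C (x a) * X : ℚ⟦X⟧) = -C (x a) := by
      simp [Derivation.leibniz]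
    rw [Finset.prod_insert ha, Derivation.leibniz, ih, h1, h2, smul_eq_mul, smul_eq_mul]
    linear_combination (C (x a) * ∏ i ∈ s, (1 - C (x i) * X)) *
      mk_pow_mul_one_sub (x a)

/-- Taking logarithmic derivatives of M·A = B gives M' = M(B'/B - A'/A), where the bracket generates
differences of power sums; read off the coefficient of degree k. -/
theorem newton_of_mul_eq {ι : Type*} (s : Finset ι) (x y : ι → ℚ) (m : ℕ → ℚ)
    (h : PowerSeries.mk m * ∏ i ∈ s, (1 - C (x i) * X) = ∏ i ∈ s, (1 - C (y i) * X)) (k : ℕ) :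
    ((k : ℚ) + 1) * m (k + 1) = ∑ p ∈ Finset.HasAntidiagonal.antidiagonal k,
      m p.1 * ∑ i ∈ s, (x i ^ (p.2 + 1) - y i ^ (p.2 + 1)) := by
  have hA : (∏ i ∈ s, (1 - C (x i) * X) : ℚ⟦X⟧) ≠ 0 := by
    intro h0
    have := congrArg constantCoeff h0
    simp [map_prod] at this
  have h' := congrArg (d⁄dX ℚ) h
  rw [Derivation.leibniz, derivative_prod_one_sub, derivative_prod_one_sub, ← h, smul_eq_mul,
    smul_eq_mul] at h'
  have h2 : d⁄dX ℚ (PowerSeries.mk m) = PowerSeries.mk m *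
      PowerSeries.mk (fun k => ∑ i ∈ s, (x i ^ (k + 1) - y i ^ (k + 1))) := by
    have h3 : PowerSeries.mk (fun k => ∑ i ∈ s, (x i ^ (k + 1) - y i ^ (k + 1))) =
        PowerSeries.mk (fun k => ∑ i ∈ s, x i ^ (k + 1)) -
          PowerSeries.mk (fun k => ∑ i ∈ s, y i ^ (k + 1)) := by
      ext; simp
    rw [h3]
    refine mul_left_cancel₀ hA ?_
    linear_combination h'
  have h4 := congrArg (coeff k) h2
  rw [coeff_derivative, coeff_mul] at h4
  simp only [coeff_mk] at h4
  rw [← h4, mul_comm]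

end Newton

/-! ### Total mass and moments of the transition weights -/

theorem chat_injOn (S : Set ℕ) : Set.InjOn (fun a : ℕ => chat a) S := fun _ _ _ _ h => chat_inj h

theorem sum_downWeight {S : Finset ℕ} (h0 : 0 ∉ S) :
    ∑ c ∈ S, downWeight S c = ∑ a ∈ S, (a : ℚ) := by
  have h := sum_prod_sub_div_prod_sub S (fun a : ℕ => chat a) (fun a : ℕ => chat (a - 1))
    (fun a ha b hb h => chat_sub_one_inj (Nat.pos_of_ne_zero fun e => h0 (e ▸ ha))
      (Nat.pos_of_ne_zero fun e => h0 (e ▸ hb)) h)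
  simp only [downWeight, neg_div, Finset.sum_neg_distrib]
  rw [h, neg_sub, ← Finset.sum_sub_distrib]
  refine Finset.sum_congr rfl fun a _ => ?_
  rw [chat_sub_chat]; ring

/-- The moments of the transition weights. -/
def upMoment (S : Finset ℕ) (k : ℕ) : ℚ := ∑ a ∈ insert 0 S, upWeight S a * chat a ^ k

/-- The power sums of the alphabet difference attached to `S`. -/
def diffPowerSum (S : Finset ℕ) (k : ℕ) : ℚ := ∑ a ∈ S, (chat a ^ k - chat (a - 1) ^ k)

open PowerSeries in
theorem mk_upMoment_mul {S : Finset ℕ} (h0 : 0 ∉ S) :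
    PowerSeries.mk (upMoment S) * ∏ a ∈ S, (1 - C (chat a) * X) =
      ∏ a ∈ S, (1 - C (chat (a - 1)) * X) := by
  have h := congrArg (Polynomial.coeToPowerSeries.ringHom (R := ℚ))
    (sum_interpolation_reverse S (insert 0 S) (fun a : ℕ => chat a) (fun a : ℕ => chat (a - 1))
      (chat_injOn _) (Finset.card_insert_of_notMem h0))
  simp only [map_sum, map_mul, map_prod, map_sub, map_one,
    Polynomial.coeToPowerSeries.ringHom_apply, Polynomial.coe_C, Polynomial.coe_X] at h
  -- The extra node 0 is harmless because chat 0 = 0 makes its factor equal to 1.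
  have h1 : (∏ a ∈ S, (1 - C (chat a) * X) : ℚ⟦X⟧) =
      ∏ a ∈ insert 0 S, (1 - C (chat a) * X) := by
    rw [Finset.prod_insert h0]; simp [chat_zero]
  have h2 : PowerSeries.mk (upMoment S) =
      ∑ a ∈ insert 0 S, C (upWeight S a) * PowerSeries.mk (fun k => chat a ^ k) := by
    ext k
    simp [upMoment]
  rw [← h, h1, h2, Finset.sum_mul]
  refine Finset.sum_congr rfl fun a ha => ?_
  rw [← Finset.mul_prod_erase _ _ ha, upWeight]
  linear_combination (C ((∏ b ∈ S, (chat a - chat (b - 1))) / ∏ b ∈ (insert 0 S).erase a,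
    (chat a - chat b)) * ∏ b ∈ (insert 0 S).erase a, (1 - C (chat b) * X)) *
      mk_pow_mul_one_sub (chat a)

theorem upMoment_zero {S : Finset ℕ} (h0 : 0 ∉ S) : upMoment S 0 = 1 := by
  have h := congrArg PowerSeries.constantCoeff (mk_upMoment_mul h0)
  rw [map_mul, map_prod, map_prod, ← PowerSeries.coeff_zero_eq_constantCoeff_apply,
    PowerSeries.coeff_mk] at h
  simpa using h

theorem upMoment_succ {S : Finset ℕ} (h0 : 0 ∉ S) (k : ℕ) :
    ((k : ℚ) + 1) * upMoment S (k + 1) =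
      ∑ p ∈ Finset.HasAntidiagonal.antidiagonal k, upMoment S p.1 * diffPowerSum S (p.2 + 1) :=
  newton_of_mul_eq S (fun a : ℕ => chat a) (fun a : ℕ => chat (a - 1)) _ (mk_upMoment_mul h0) k

/-! ### The weight filtration on polynomials in content power sums -/

namespace StrictPartition

/-- The power sum of the modified contents of the boxes. -/
def contentPowerSum (k : ℕ) (lam : StrictPartition) : ℚ :=
  ∑ a ∈ lam.partSet, ∑ c ∈ Finset.range a, chat c ^ k

/-- The weight of a product of content power sums. -/
def prodWeight (κ : Multiset ℕ) : ℕ := (κ.map (· + 1)).sum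

/-- A product of content power sums. -/
def contentProd (κ : Multiset ℕ) : StrictPartition → ℚ := (κ.map contentPowerSum).prod

/-- The span of the products of content power sums of weight at most `d`. -/
def contentFiltration (d : ℕ) : Submodule ℚ (StrictPartition → ℚ) :=
  Submodule.span ℚ (contentProd '' {κ | prodWeight κ ≤ d})

theorem contentProd_cons (k : ℕ) (κ : Multiset ℕ) :
    contentProd (k ::ₘ κ) = contentPowerSum k * contentProd κ := by simp [contentProd]

theorem prodWeight_cons (k : ℕ) (κ : Multiset ℕ) :
    prodWeight (k ::ₘ κ) = k + 1 + prodWeight κ := by simp [prodWeight]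

theorem contentProd_mem {κ : Multiset ℕ} {d : ℕ} (h : prodWeight κ ≤ d) :
    contentProd κ ∈ contentFiltration d := Submodule.subset_span ⟨κ, h, rfl⟩

theorem contentFiltration_mono {d e : ℕ} (h : d ≤ e) :
    contentFiltration d ≤ contentFiltration e :=
  Submodule.span_mono (Set.image_mono fun _ hκ => le_trans hκ h)

theorem mul_mem_contentFiltration {d e n : ℕ} {f g : StrictPartition → ℚ}
    (hf : f ∈ contentFiltration d) (hg : g ∈ contentFiltration e) (h : d + e ≤ n) :
    f * g ∈ contentFiltration n := by
  have := Submodule.mul_mem_mul hf hg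
  rw [contentFiltration, contentFiltration, Submodule.span_mul_span] at this
  refine Submodule.span_mono ?_ this
  rintro _ ⟨_, ⟨κ, hκ, rfl⟩, _, ⟨κ', hκ', rfl⟩, rfl⟩
  refine ⟨κ + κ', ?_, by simp [contentProd]⟩
  have h1 : prodWeight κ ≤ d := hκ
  have h2 : prodWeight κ' ≤ e := hκ'
  have : prodWeight (κ + κ') = prodWeight κ + prodWeight κ' := by simp [prodWeight]
  show prodWeight (κ + κ') ≤ n
  omega

theorem contentPowerSum_mem {k d : ℕ} (h : k + 1 ≤ d) :
    contentPowerSum k ∈ contentFiltration d := by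
  have := contentProd_mem (κ := {k}) (d := d) (by simpa [prodWeight] using h)
  simpa [contentProd] using this

theorem one_mem_contentFiltration (d : ℕ) : 1 ∈ contentFiltration d := by
  simpa [contentProd] using contentProd_mem (κ := 0) (d := d) (by simp [prodWeight])

/-- The polynomials expressing second differences of powers of `chat`. -/
def secondDiffPoly : ℕ → ℚ[X]
  | 0 => 0
  | 1 => 1
  | k + 2 => (2 * .X + 1) * secondDiffPoly (k + 1) - (.X ^ 2 - .X) * secondDiffPoly k +
      4 * .X ^ (k + 1)

open Polynomial in
theorem degree_secondDiffPoly_lt (k : ℕ) : (secondDiffPoly k).degree < k := by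
  induction k using Nat.twoStepInduction with
  | zero => simp [secondDiffPoly]
  | one => simp only [secondDiffPoly, degree_one]; norm_num
  | more k h0 h1 =>
    rw [← mem_degreeLT] at h0 h1 ⊢
    rw [secondDiffPoly]
    have hX : ∀ (n m l : ℕ) (p : ℚ[X]), p ∈ degreeLT ℚ n → n + m ≤ l →
        X ^ m * p ∈ degreeLT ℚ l := by
      intro n m l p hp hl
      refine degreeLT_mono hl ?_
      rw [mem_degreeLT] at hp ⊢
      rw [degree_mul, degree_X_pow, add_comm, Nat.cast_add]
      exact WithBot.add_lt_add_right (WithBot.coe_ne_bot) hp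
    have e : (2 * X + 1) * secondDiffPoly (k + 1) - (X ^ 2 - X) * secondDiffPoly k +
        4 * X ^ (k + 1) = (2 : ℚ) • (X ^ 1 * secondDiffPoly (k + 1)) + secondDiffPoly (k + 1) -
          X ^ 2 * secondDiffPoly k + X ^ 1 * secondDiffPoly k + (4 : ℚ) • X ^ (k + 1) := by
      simp only [smul_eq_C_mul, map_ofNat]; ring
    rw [e]
    have t1 := hX _ 1 (k + 2) _ h1 le_rfl
    have t2 := degreeLT_mono (show k + 1 ≤ k + 2 by omega) h1
    have t3 := hX _ 2 (k + 2) _ h0 le_rfl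
    have t4 := hX _ 1 (k + 2) _ h0 (by omega)
    have t5 : (X ^ (k + 1) : ℚ[X]) ∈ degreeLT ℚ (k + 2) := by
      rw [mem_degreeLT, degree_X_pow]
      exact_mod_cast Nat.lt_succ_self _
    exact add_mem (add_mem (sub_mem (add_mem (Submodule.smul_mem _ _ t1) t2) t3) t4)
      (Submodule.smul_mem _ _ t5)

/-- With x = chat a, the numbers chat(a+1) and chat(a-1) have sum 2x + 1 and product x² - x. Their
power sums therefore obey a two-term recursion with coefficients polynomial in x, and correcting by
-2x^k creates the term 4x^{k+1}. -/
theorem eval_secondDiffPoly (k : ℕ) (a : ℚ) :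
    (secondDiffPoly k).eval (chat a) = chat (a + 1) ^ k - 2 * chat a ^ k + chat (a - 1) ^ k := by
  induction k using Nat.twoStepInduction with
  | zero => simp [secondDiffPoly]; norm_num
  | one => simp [secondDiffPoly, chat]; ring
  | more k h0 h1 =>
    simp only [secondDiffPoly, Polynomial.eval_add, Polynomial.eval_sub, Polynomial.eval_mul,
      Polynomial.eval_pow, Polynomial.eval_X, Polynomial.eval_ofNat, Polynomial.eval_one, h0, h1]
    have hs : chat (a + 1) + chat (a - 1) = 2 * chat a + 1 := by unfold chat; ring
    have hp : chat (a + 1) * chat (a - 1) = chat a ^ 2 - chat a := by unfold chat; ring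
    rw [← hs, ← hp]
    generalize chat (a + 1) = u at *
    generalize chat (a - 1) = v at *
    linear_combination (2 * chat a ^ k) * hp + (-2 * chat a ^ (k + 1)) * hs

theorem sum_range_secondDiff {k : ℕ} (hk : k ≠ 0) (a : ℕ) :
    ∑ c ∈ Finset.range a, (secondDiffPoly k).eval (chat c) = chat a ^ k - chat (a - 1) ^ k := by
  induction a with
  | zero => simp [chat, hk]
  | succ a ih =>
    rw [Finset.sum_range_succ, ih, eval_secondDiffPoly]
    push_cast
    rw [add_sub_cancel_right]; ring

/-- Telescoping each row writes the difference as a sum over its boxes of a polynomial of degree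
below k in the content, hence as a combination of power sums of weight at most k. -/
theorem diffPowerSum_mem {k : ℕ} (hk : k ≠ 0) :
    (fun lam : StrictPartition => diffPowerSum lam.partSet k) ∈ contentFiltration k := by
  have : (fun lam : StrictPartition => diffPowerSum lam.partSet k) =
      ∑ j ∈ Finset.range k, (secondDiffPoly k).coeff j • contentPowerSum j := by
    funext lam
    simp only [diffPowerSum, ← sum_range_secondDiff hk, Finset.sum_apply, Pi.smul_apply,
      contentPowerSum, smul_eq_mul, Finset.mul_sum]
    rw [Finset.sum_comm]
    refine Finset.sum_congr rfl fun a _ => ?_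
    rw [Finset.sum_comm]
    refine Finset.sum_congr rfl fun c _ => ?_
    refine Polynomial.eval_eq_sum_range' ?_ _
    have h := degree_secondDiffPoly_lt k
    by_cases h0 : secondDiffPoly k = 0
    · rw [h0, Polynomial.natDegree_zero]; omega
    · exact (Polynomial.natDegree_lt_iff_degree_lt h0).mpr h
  rw [this]
  exact Submodule.sum_mem _ fun j hj => Submodule.smul_mem _ _
    (contentPowerSum_mem (Finset.mem_range.mp hj))

theorem upMoment_mem (k : ℕ) :
    (fun lam : StrictPartition => upMoment lam.partSet k) ∈ contentFiltration k := by
  induction k using Nat.strong_induction_on with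
  | _ k ih =>
    rcases k with _ | k
    · have : (fun lam : StrictPartition => upMoment lam.partSet 0) = 1 := by
        funext lam
        exact upMoment_zero lam.zero_notMem_partSet
      rw [this]
      exact one_mem_contentFiltration _
    · have : (fun lam : StrictPartition => upMoment lam.partSet (k + 1)) =
          ((k : ℚ) + 1)⁻¹ • ∑ p ∈ Finset.HasAntidiagonal.antidiagonal k,
            (fun lam : StrictPartition => upMoment lam.partSet p.1) *
              (fun lam : StrictPartition => diffPowerSum lam.partSet (p.2 + 1)) := by
        funext lam
        have hk : (k : ℚ) + 1 ≠ 0 := by positivity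
        simp only [Pi.smul_apply, Finset.sum_apply, Pi.mul_apply, smul_eq_mul,
          ← upMoment_succ lam.zero_notMem_partSet]
        rw [inv_mul_cancel_left₀ hk]
      rw [this]
      refine Submodule.smul_mem _ _ (Submodule.sum_mem _ fun p hp => ?_)
      have := Finset.HasAntidiagonal.mem_antidiagonal.mp hp
      exact mul_mem_contentFiltration (ih p.1 (by omega)) (diffPowerSum_mem (Nat.succ_ne_zero _))
        (by omega)

/-- A product of content power sums after adding a box of modified content `x`. -/
def shiftedProd (κ : Multiset ℕ) (x : ℚ) (lam : StrictPartition) : ℚ :=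
  (κ.map fun k => contentPowerSum k lam + x ^ k).prod

/-- The heart of the degree drop. Writing A for the product over κ and A' for its shift, (p_k +
x^k)A' - p_k A = p_k(A' - A) + x^k(A' - A) + x^k A. The exponent `j` is carried along so that the
middle term falls under the induction hypothesis; the last term is a moment times A. -/
theorem sum_upWeight_shiftedProd_sub_mem (κ : Multiset ℕ) (j d : ℕ) (h : prodWeight κ + j ≤ d + 1) :
    (fun lam : StrictPartition => ∑ a ∈ insert 0 lam.partSet, upWeight lam.partSet a * chat a ^ j *
      (shiftedProd κ (chat a) lam - contentProd κ lam)) ∈ contentFiltration d := by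
  induction κ using Multiset.induction_on generalizing j d with
  | empty =>
    have : (fun lam : StrictPartition => ∑ a ∈ insert 0 lam.partSet,
        upWeight lam.partSet a * chat a ^ j *
          (shiftedProd 0 (chat a) lam - contentProd 0 lam)) = 0 := by
      funext lam; simp [shiftedProd, contentProd]
    rw [this]
    exact zero_mem _
  | cons k κ ih =>
    rw [prodWeight_cons] at h
    have : (fun lam : StrictPartition => ∑ a ∈ insert 0 lam.partSet,
        upWeight lam.partSet a * chat a ^ j *
          (shiftedProd (k ::ₘ κ) (chat a) lam - contentProd (k ::ₘ κ) lam)) =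
        contentPowerSum k * (fun lam : StrictPartition => ∑ a ∈ insert 0 lam.partSet,
          upWeight lam.partSet a * chat a ^ j *
            (shiftedProd κ (chat a) lam - contentProd κ lam)) +
        (fun lam : StrictPartition => ∑ a ∈ insert 0 lam.partSet,
          upWeight lam.partSet a * chat a ^ (j + k) *
            (shiftedProd κ (chat a) lam - contentProd κ lam)) +
        (fun lam : StrictPartition => upMoment lam.partSet (j + k)) * contentProd κ := by
      funext lam
      simp only [Pi.add_apply, Pi.mul_apply, upMoment, Finset.mul_sum, Finset.sum_mul,
        ← Finset.sum_add_distrib]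
      refine Finset.sum_congr rfl fun a _ => ?_
      rw [contentProd_cons, shiftedProd, Multiset.map_cons, Multiset.prod_cons, ← shiftedProd,
        Pi.mul_apply]
      ring
    rw [this]
    refine add_mem (add_mem ?_ (ih _ _ (by omega))) ?_
    -- An empty κ gives A' = A = 1 and the term vanishes. Otherwise κ has weight at least 1, so k +
    -- 1 ≤ d and the subtraction `d - (k + 1)` does not truncate.
    · rcases κ.empty_or_exists_mem with rfl | ⟨b, hb⟩
      · convert zero_mem (contentFiltration d)
        funext lam
        simp [shiftedProd, contentProd]
      · obtain ⟨κ', rfl⟩ := Multiset.exists_cons_of_mem hb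
        rw [prodWeight_cons] at h
        exact mul_mem_contentFiltration (contentPowerSum_mem le_rfl)
          (ih j (d - (k + 1)) (by rw [prodWeight_cons]; omega)) (by omega)
    · exact mul_mem_contentFiltration (upMoment_mem _) (contentProd_mem le_rfl) (by omega)

end StrictPartition

/-! ### The growth operator lowers the filtration -/

namespace StrictPartition

theorem zero_notMem_addBox (lam : StrictPartition) (a : ℕ) :
    0 ∉ insert (a + 1) (lam.partSet.erase a) := by
  simp [zero_notMem_partSet]

/-- The weight `2^{-ℓ(λ)} g^λ / |λ|!`. -/
def planchWeight (lam : StrictPartition) : ℚ := 2⁻¹ ^ lam.partSet.card * hookProd lam.partSet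

theorem planchWeight_pos (lam : StrictPartition) : 0 < planchWeight lam :=
  mul_pos (by positivity) (hookProd_pos _)

/-- The averaging operator of the growth process on strict partitions. -/
def upOp : (StrictPartition → ℚ) →ₗ[ℚ] (StrictPartition → ℚ) where
  toFun f lam := ∑ nu ∈ lam.upper, 2 * planchWeight nu / planchWeight lam * f nu
  map_add' f g := by
    funext lam
    simp [mul_add, Finset.sum_add_distrib]
  map_smul' c f := by
    funext lam
    simp only [Pi.smul_apply, smul_eq_mul, RingHom.id_apply, Finset.mul_sum]
    exact Finset.sum_congr rfl fun _ _ => by ring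

theorem upOp_apply (f : StrictPartition → ℚ) (lam : StrictPartition) :
    upOp f lam = ∑ nu ∈ lam.upper, 2 * planchWeight nu / planchWeight lam * f nu := rfl

/-- The sum can run over all parts and 0, because `upWeight` vanishes where a + 1 is already a part,
that is, where no box can be added. -/
theorem upOp_eq_sum_upWeight (f : StrictPartition → ℚ) (lam : StrictPartition) (Ψ : ℕ → ℚ)
    (h : ∀ a ∈ insert 0 lam.partSet, ∀ nu : StrictPartition, a + 1 ∉ lam.partSet →
      nu.partSet = insert (a + 1) (lam.partSet.erase a) → f nu = Ψ a) :
    upOp f lam = ∑ a ∈ insert 0 lam.partSet, upWeight lam.partSet a * Ψ a := by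
  have hfil : ∑ a ∈ insert 0 lam.partSet with a + 1 ∉ lam.partSet, upWeight lam.partSet a * Ψ a =
      ∑ a ∈ insert 0 lam.partSet, upWeight lam.partSet a * Ψ a := by
    refine Finset.sum_filter_of_ne fun a _ hne hmem => hne ?_
    rw [upWeight_eq_zero hmem, zero_mul]
  rw [← hfil, upOp_apply]
  choose g hg using fun a : ℕ => partSet_surjective (zero_notMem_addBox lam a)
  symm
  refine Finset.sum_bij (fun a _ => g a) ?_ ?_ ?_ ?_
  · intro a ha
    rw [Finset.mem_filter] at ha
    exact mem_upper.mpr (addsOneBox_of_part ha.1 ha.2 (hg a))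
  · intro a ha a' _ hgg
    rw [Finset.mem_filter] at ha
    have h1 : a + 1 ∈ insert (a' + 1) (lam.partSet.erase a') := by
      rw [← hg a', ← hgg, hg a]; simp
    rcases Finset.mem_insert.mp h1 with h1 | h1
    · omega
    · exact absurd (Finset.mem_of_mem_erase h1) ha.2
  · intro nu hnu
    obtain ⟨a, ha, ha1, hS⟩ := (mem_upper.mp hnu).exists_part
    exact ⟨a, Finset.mem_filter.mpr ⟨ha, ha1⟩, partSet_injective ((hg a).trans hS.symm)⟩
  · intro a ha
    rw [Finset.mem_filter] at ha
    rw [h a ha.1 (g a) ha.2 (hg a)]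
    have h1 := hookProd_up lam.zero_notMem_partSet ha.1 ha.2
    rw [← hg a] at h1
    change 2 * planchWeight (g a) = upWeight lam.partSet a * planchWeight lam at h1
    rw [h1, mul_div_cancel_right₀ _ (planchWeight_pos lam).ne']

theorem contentPowerSum_addBox {lam nu : StrictPartition} {a : ℕ} (ha : a ∈ insert 0 lam.partSet)
    (ha1 : a + 1 ∉ lam.partSet) (h : nu.partSet = insert (a + 1) (lam.partSet.erase a)) (k : ℕ) :
    contentPowerSum k nu = contentPowerSum k lam + chat a ^ k := by
  rw [contentPowerSum, contentPowerSum, h,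
    Finset.sum_insert (fun h => ha1 (Finset.mem_of_mem_erase h)), Finset.sum_range_succ]
  rcases Finset.mem_insert.mp ha with rfl | ha
  · rw [Finset.erase_eq_of_notMem lam.zero_notMem_partSet]; simp [add_comm]
  · rw [← Finset.sum_erase_add _ _ ha]; ring

theorem contentProd_addBox {lam nu : StrictPartition} {a : ℕ} (ha : a ∈ insert 0 lam.partSet)
    (ha1 : a + 1 ∉ lam.partSet) (h : nu.partSet = insert (a + 1) (lam.partSet.erase a))
    (κ : Multiset ℕ) : contentProd κ nu = shiftedProd κ (chat a) lam := by
  induction κ using Multiset.induction_on with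
  | empty => simp [contentProd, shiftedProd]
  | cons k κ ih =>
    rw [contentProd_cons, Pi.mul_apply, ih, contentPowerSum_addBox ha ha1 h, shiftedProd,
      shiftedProd, Multiset.map_cons, Multiset.prod_cons]

theorem upOp_contentProd_sub (κ : Multiset ℕ) :
    upOp (contentProd κ) - contentProd κ = fun lam : StrictPartition =>
      ∑ a ∈ insert 0 lam.partSet, upWeight lam.partSet a * chat a ^ 0 *
        (shiftedProd κ (chat a) lam - contentProd κ lam) := by
  funext lam
  have h1 := upMoment_zero lam.zero_notMem_partSet
  rw [Pi.sub_apply, upOp_eq_sum_upWeight (contentProd κ) lam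
    (fun a => shiftedProd κ (chat a) lam) fun a ha nu ha1 h => contentProd_addBox ha ha1 h κ]
  simp only [mul_sub, Finset.sum_sub_distrib, ← Finset.sum_mul]
  rw [← upMoment, h1, one_mul]
  simp

/-- Since the weights sum to 1, U - 1 averages the increment of f, and the case j = 0 of
`sum_upWeight_shiftedProd_sub_mem` applies to each generator. -/
theorem upOp_sub_mem {d : ℕ} {f : StrictPartition → ℚ} (hf : f ∈ contentFiltration (d + 1)) :
    upOp f - f ∈ contentFiltration d := by
  suffices contentFiltration (d + 1) ≤ (contentFiltration d).comap (upOp - LinearMap.id) from this hf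
  refine Submodule.span_le.mpr ?_
  rintro _ ⟨κ, hκ, rfl⟩
  change upOp (contentProd κ) - contentProd κ ∈ contentFiltration d
  rw [upOp_contentProd_sub]
  exact sum_upWeight_shiftedProd_sub_mem κ 0 d hκ

theorem upOp_of_mem_zero {f : StrictPartition → ℚ} (hf : f ∈ contentFiltration 0) :
    upOp f = f := by
  suffices contentFiltration 0 ≤ LinearMap.ker (upOp - LinearMap.id) from
    sub_eq_zero.mp (LinearMap.mem_ker.mp (this hf))
  refine Submodule.span_le.mpr ?_
  rintro _ ⟨κ, hκ, rfl⟩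
  change upOp (contentProd κ) - contentProd κ = 0
  rcases κ.empty_or_exists_mem with rfl | ⟨b, hb⟩
  · rw [upOp_contentProd_sub]
    funext lam
    simp [shiftedProd, contentProd]
  · obtain ⟨κ', rfl⟩ := Multiset.exists_cons_of_mem hb
    have : prodWeight (b ::ₘ κ') ≤ 0 := hκ
    rw [prodWeight_cons] at this
    omega

/-! ### The product formula for the number of shifted tableaux -/

/-- The ratios for the removable boxes are the down weights, which sum to Σ_c (chat c - chat(c-1)) =
Σ_c c = |λ|. This is the recursion that proves the product formula. -/
theorem sum_lower_hookProd (lam : StrictPartition) :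
    ∑ nu ∈ lam.lower, hookProd nu.partSet = lam.size * hookProd lam.partSet := by
  have h0 := lam.zero_notMem_partSet
  have hfil : ∑ c ∈ lam.partSet with c - 1 ∉ lam.partSet, downWeight lam.partSet c =
      ∑ c ∈ lam.partSet, downWeight lam.partSet c := by
    refine Finset.sum_filter_of_ne fun c hc hne hmem => hne ?_
    have := downWeight_eq_zero hmem
    rwa [Nat.sub_add_cancel (pos_of_mem hc)] at this
  rw [size_eq_sum, Nat.cast_sum, ← sum_downWeight h0, ← hfil, Finset.sum_mul]
  -- Erasing 0 covers the case c = 1, where the row disappears.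
  choose g hg using fun c : ℕ =>
    partSet_surjective (S := (insert (c - 1) (lam.partSet.erase c)).erase 0) (by simp)
  symm
  refine Finset.sum_bij (fun c _ => g c) ?_ ?_ ?_ ?_
  · intro c hc
    obtain ⟨hc, hc'⟩ := Finset.mem_filter.mp hc
    obtain ⟨a, rfl⟩ : ∃ a, c = a + 1 := ⟨c - 1, by have := pos_of_mem hc; omega⟩
    rw [Nat.add_sub_cancel] at hc'
    refine mem_lower.mpr (addsOneBox_of_part (a := a) ?_ ?_ ?_) <;> rw [hg, Nat.add_sub_cancel]
    · by_cases ha : a = 0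
      · simp [ha]
      · simp [ha]
    · simp
    · ext b
      simp only [Finset.mem_insert, Finset.mem_erase]
      by_cases hb : b = a + 1
      · simp [hb, hc]
      · by_cases hba : b = a
        · simp [hba, hc']
        · by_cases hb0 : b = 0
          · simp [hb0, h0]
          · simp [hb, hba, hb0]
  · intro c hc c' hc' h
    by_contra hne
    have h1 : c ∈ (g c').partSet := by
      rw [hg]
      have := Finset.mem_of_mem_filter _ hc
      simp [this, hne, (pos_of_mem this).ne']
    rw [← h, hg] at h1
    have := pos_of_mem (Finset.mem_of_mem_filter _ hc)
    simp only [Finset.mem_erase, Finset.mem_insert, ne_eq, not_true_eq_false, false_and,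
      or_false] at h1
    omega
  · intro nu hnu
    obtain ⟨a, ha, ha1, hS⟩ := (mem_lower.mp hnu).exists_part
    refine ⟨a + 1, ?_, partSet_injective ?_⟩
    · rw [Finset.mem_filter, hS]
      simp
    · rw [hg, hS, Nat.add_sub_cancel, Finset.erase_insert (by simp [ha1])]
      ext b
      have := nu.zero_notMem_partSet
      by_cases hb0 : b = 0
      · simp [hb0, this]
      · by_cases hba : b = a
        · subst hba
          simpa [hb0] using ha
        · simp [hb0, hba]
  · intro c hc
    obtain ⟨hc, hc'⟩ := Finset.mem_filter.mp hc
    obtain ⟨a, rfl⟩ : ∃ a, c = a + 1 := ⟨c - 1, by have := pos_of_mem hc; omega⟩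
    rw [Nat.add_sub_cancel] at hc'
    have h1 := hookProd_down (R := lam.partSet.erase (a + 1)) (a := a) (by simp [h0]) (by simp)
      (by simp [hc'])
    rw [Finset.insert_erase hc] at h1
    rw [← h1, hg, Nat.add_sub_cancel]
    by_cases ha : a = 0
    · subst ha
      rw [Finset.erase_insert (by simp [h0]), hookProd_insert_zero (by simp [h0])]
    · rw [Finset.erase_eq_of_notMem (s := insert a _)]
      simp [h0, Ne.symm ha]

theorem partSet_empty : empty.partSet = ∅ := by simp [partSet, empty]

theorem size_empty : empty.size = 0 := by simp [size, empty]

theorem eq_empty_of_size {lam : StrictPartition} (h : lam.size = 0) : lam = empty := by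
  refine partSet_injective ?_
  rw [partSet_empty, Finset.eq_empty_iff_forall_notMem]
  intro a ha
  rw [size_eq_sum, Finset.sum_eq_zero_iff] at h
  exact (pos_of_mem ha).ne' (h a ha)

theorem card_boxPath_empty (n : ℕ) {lam : StrictPartition} (h : lam.size = n) :
    (Nat.card (BoxPath n empty lam) : ℚ) = (n ! : ℕ) * hookProd lam.partSet := by
  induction n generalizing lam with
  | zero =>
    rw [eq_empty_of_size h, card_boxPath_zero, partSet_empty]
    simp [hookProd]
  | succ n ih =>
    rw [card_boxPath_succ, Nat.cast_sum, Finset.sum_congr rfl fun nu hnu => ih (lam := nu) (by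
      have := (mem_lower.mp hnu).size_eq; omega), ← Finset.mul_sum, sum_lower_hookProd, h,
      Nat.factorial_succ]
    push_cast
    ring

theorem numTableaux_eq (lam : StrictPartition) :
    (lam.numTableaux : ℚ) = (lam.size ! : ℕ) * hookProd lam.partSet := by
  rw [numTableaux, numSkewTableaux_eq (k := lam.size) (by rw [size_empty, add_zero]),
    card_boxPath_empty _ rfl]

/-! ### Iterating the operator, and polynomiality in n -/

/-- The expectation of `f` after `n` steps of the growth process started at `mu`. -/
def pathSum (mu : StrictPartition) (n : ℕ) (f : StrictPartition → ℚ) : ℚ :=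
  ∑ lam ∈ ofSize (n + mu.size),
    2 ^ n * (planchWeight lam / planchWeight mu) * Nat.card (BoxPath n mu lam) * f lam

theorem pathSum_zero (mu : StrictPartition) (f : StrictPartition → ℚ) :
    pathSum mu 0 f = f mu := by
  rw [pathSum, Finset.sum_eq_single mu]
  · rw [card_boxPath_zero, div_self (planchWeight_pos mu).ne']; simp
  · intro lam _ h
    rw [card_boxPath_zero_of_ne h]; simp
  · intro h
    exact absurd (mem_ofSize.mpr (zero_add _).symm) h

/-- Split off the last box of a path and exchange the two sums: the intermediate weights cancel and
the inner sum is `upOp f`. -/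
theorem pathSum_succ (mu : StrictPartition) (n : ℕ) (f : StrictPartition → ℚ) :
    pathSum mu (n + 1) f = pathSum mu n (upOp f) := by
  simp only [pathSum, card_boxPath_succ, upOp_apply, Nat.cast_sum, Finset.mul_sum, Finset.sum_mul]
  rw [Finset.sum_comm' (t' := ofSize (n + mu.size)) (s' := fun nu => nu.upper)]
  · refine Finset.sum_congr rfl fun nu _ => Finset.sum_congr rfl fun lam _ => ?_
    have := (planchWeight_pos nu).ne'
    have := (planchWeight_pos mu).ne'
    field_simp
    ring
  · intro lam nu
    rw [mem_ofSize, mem_ofSize, mem_lower, mem_upper]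
    constructor
    · rintro ⟨h1, h2⟩
      exact ⟨h2, by have := h2.size_eq; omega⟩
    · rintro ⟨h1, h2⟩
      exact ⟨by have := h1.size_eq; omega, h1⟩

theorem pathSum_sub (mu : StrictPartition) (n : ℕ) (f g : StrictPartition → ℚ) :
    pathSum mu n (f - g) = pathSum mu n f - pathSum mu n g := by
  simp only [pathSum, Pi.sub_apply, mul_sub, Finset.sum_sub_distrib]

/-- The forward difference in n of `pathSum mu n f` is `pathSum mu n (upOp f - f)`, one filtration
step lower. Summing back with Pascal's rule shifts the coefficients by one, with initial value f(μ).
-/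
theorem exists_pathSum_eq_sum_choose (mu : StrictPartition) (d : ℕ) {f : StrictPartition → ℚ}
    (hf : f ∈ contentFiltration d) :
    ∃ c : ℕ → ℚ, ∀ n, pathSum mu n f = ∑ k ∈ Finset.range (d + 1), (n.choose k : ℚ) * c k := by
  induction d generalizing f with
  | zero =>
    refine ⟨fun _ => f mu, fun n => ?_⟩
    induction n with
    | zero => simp [pathSum_zero]
    | succ n ih =>
      rw [pathSum_succ, upOp_of_mem_zero hf, ih]
      simp
  | succ d ih =>
    obtain ⟨c, hc⟩ := ih (upOp_sub_mem hf)
    refine ⟨fun k => Nat.casesOn k (f mu) c, fun n => ?_⟩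
    rw [Finset.sum_range_succ']
    induction n with
    | zero => simp [pathSum_zero]
    | succ n ihn =>
      have h := hc n
      rw [pathSum_sub, ← pathSum_succ, sub_eq_iff_eq_add, ihn] at h
      rw [h, ← add_assoc, ← Finset.sum_add_distrib]
      simp only [Nat.choose_succ_succ, Nat.cast_add, add_mul, Nat.choose_zero_right]

theorem exists_polynomial_pathSum (mu : StrictPartition) (d : ℕ) {f : StrictPartition → ℚ}
    (hf : f ∈ contentFiltration d) : ∃ P : ℚ[X], ∀ n : ℕ, pathSum mu n f = P.eval (n : ℚ) := by
  obtain ⟨c, hc⟩ := exists_pathSum_eq_sum_choose mu d hf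
  refine ⟨∑ k ∈ Finset.range (d + 1),
    descPochhammer ℚ k * Polynomial.C (((k ! : ℕ) : ℚ)⁻¹ * c k), fun n => ?_⟩
  rw [hc, Polynomial.eval_finsetSum]
  refine Finset.sum_congr rfl fun k _ => ?_
  rw [Polynomial.eval_mul, Polynomial.eval_C, descPochhammer_eval_eq_descFactorial,
    Nat.descFactorial_eq_factorial_mul_choose]
  have : ((k ! : ℕ) : ℚ) ≠ 0 := by positivity
  push_cast
  field_simp

end StrictPartition

/-! ### Augmented monomials in terms of power sums -/

section AugmentedMonomial

/-- The augmented monomial symmetric function with exponents `α` at the point `x`. -/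
def augMonomial {ι : Type*} [Fintype ι] {r : ℕ} (α : Fin r → ℕ) (x : ι → ℚ) : ℚ :=
  open Classical in ∑ f : Fin r ↪ ι, ∏ t, x (f t) ^ α t

theorem augMonomial_zero {ι : Type*} [Fintype ι] (α : Fin 0 → ℕ) (x : ι → ℚ) :
    augMonomial α x = 1 := by
  simp [augMonomial]

/-- Let the first index run freely, giving a power sum, and subtract the cases where it meets a
later index t; there the two exponents add up. -/
theorem augMonomial_succ {ι : Type*} [Fintype ι] {r : ℕ} (α : Fin (r + 1) → ℕ) (x : ι → ℚ) :
    augMonomial α x = (∑ i, x i ^ α 0) * augMonomial (fun t => α t.succ) x -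
      ∑ t, augMonomial (Function.update (fun t => α t.succ) t (α t.succ + α 0)) x := by
  classical
  have h1 : augMonomial α x = ∑ f : Fin r ↪ ι, ∑ i : {i // i ∉ Set.range f},
      x i ^ α 0 * ∏ t : Fin r, x (f t) ^ α t.succ := by
    rw [augMonomial, ← (Equiv.embeddingFinSucc r ι).symm.sum_comp, Fintype.sum_sigma]
    refine Finset.sum_congr rfl fun f _ => Finset.sum_congr rfl fun i _ => ?_
    rw [Fin.prod_univ_succ]
    simp
  have h2 : ∀ f : Fin r ↪ ι, ∑ i : {i // i ∉ Set.range f}, x i ^ α 0 =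
      ∑ i, x i ^ α 0 - ∑ t, x (f t) ^ α 0 := by
    intro f
    rw [eq_sub_iff_add_eq', ← Fintype.sum_subtype_add_sum_subtype (fun i => i ∈ Set.range f)]
    congr 1
    convert (Equiv.ofInjective f f.injective).sum_comp (fun i => x i.1 ^ α 0)
    rfl
  have h3 : ∀ (f : Fin r ↪ ι) (t : Fin r),
      ∏ u, x (f u) ^ Function.update (fun t => α t.succ) t (α t.succ + α 0) u =
        x (f t) ^ α 0 * ∏ u, x (f u) ^ α u.succ := by
    intro f t
    rw [← Finset.mul_prod_erase _ _ (Finset.mem_univ t),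
      ← Finset.mul_prod_erase _ (fun u => x (f u) ^ α u.succ) (Finset.mem_univ t),
      Function.update_self, pow_add]
    rw [Finset.prod_congr rfl fun u hu => by
      rw [Function.update_of_ne (Finset.ne_of_mem_erase hu)]]
    ring
  rw [h1]
  simp only [augMonomial, ← Finset.sum_mul, h2, sub_mul, Finset.sum_sub_distrib, h3]
  congr 1
  · rw [Finset.mul_sum]
  · rw [Finset.sum_comm]
    simp only [Finset.sum_mul]

end AugmentedMonomial

/-! ### Expanding a symmetric function uniformly in the number of variables -/

namespace SymmetricFunction

variable (F : SymmetricFunction)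

theorem coeff_castSucc (N : ℕ) (s : Fin N →₀ ℕ) :
    (F.poly (N + 1)).coeff (s.mapDomain Fin.castSucc) = (F.poly N).coeff s := by
  have h : MvPolynomial.aeval
      (Fin.snoc (α := fun _ => MvPolynomial (Fin N) ℚ) MvPolynomial.X 0) =
      MvPolynomial.killCompl (R := ℚ) (Fin.castSucc_injective N) := by
    ext1 i
    refine Fin.lastCases ?_ (fun i => ?_) i
    · rw [MvPolynomial.aeval_X, Fin.snoc_last, MvPolynomial.killCompl, MvPolynomial.aeval_X,
        dif_neg]
      rintro ⟨j, hj⟩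
      exact (Fin.castSucc_lt_last j).ne hj
    · rw [MvPolynomial.aeval_X, Fin.snoc_castSucc]
      have := MvPolynomial.killCompl_rename_app (R := ℚ) (Fin.castSucc_injective N)
        (MvPolynomial.X i)
      rwa [MvPolynomial.rename_X, eq_comm] at this
  rw [← F.stable N, h, MvPolynomial.coeff_killCompl]

theorem coeff_castLE {r N : ℕ} (h : r ≤ N) (s : Fin r →₀ ℕ) :
    (F.poly N).coeff (s.mapDomain (Fin.castLE h)) = (F.poly r).coeff s := by
  induction N, h using Nat.le_induction with
  | base =>
    rw [show Fin.castLE (le_refl r) = id from rfl, Finsupp.mapDomain_id]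
  | succ N h ih =>
    rw [← ih, ← F.coeff_castSucc N, ← Finsupp.mapDomain_comp]
    rfl

/-- Stability gives this for the standard inclusion; any embedding differs from that one by a
permutation of the variables, and symmetry absorbs it. -/
theorem coeff_embDomain {r N : ℕ} (f : Fin r ↪ Fin N) (s : Fin r →₀ ℕ) :
    (F.poly N).coeff (s.embDomain f) = (F.poly r).coeff s := by
  classical
  have h : r ≤ N := by simpa using Fintype.card_le_of_embedding f
  let e : {x // x ∈ Set.range (Fin.castLE h)} ≃ {x // x ∈ Set.range f} :=
    (Equiv.ofInjective _ (Fin.castLE_injective h)).symm.trans (Equiv.ofInjective f f.injective)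
  have he : ∀ t, e.extendSubtype (Fin.castLE h t) = f t := by
    intro t
    rw [Equiv.extendSubtype_apply_of_mem e _ ⟨t, rfl⟩]
    have : (⟨Fin.castLE h t, ⟨t, rfl⟩⟩ : {x // x ∈ Set.range (Fin.castLE h)}) =
      Equiv.ofInjective _ (Fin.castLE_injective h) t := rfl
    rw [this]
    simp [e]
  have key : s.embDomain f = (s.mapDomain (Fin.castLE h)).mapDomain e.extendSubtype := by
    rw [← Finsupp.mapDomain_comp, Finsupp.embDomain_eq_mapDomain]
    congr 1
    funext t
    exact (he t).symm
  rw [← F.coeff_castLE h, key]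
  conv_lhs => rw [← F.symmetric N e.extendSubtype]
  exact MvPolynomial.coeff_rename_mapDomain _ e.extendSubtype.injective _ _

theorem card_embedding_map_eq {N r : ℕ} (T : Finset (Fin N)) (h : T.card = r) :
    (Finset.univ.filter fun f : Fin r ↪ Fin N => Finset.univ.map f = T).card = r ! := by
  have h1 : Fintype.card (Fin r ↪ T) = r ! := by
    rw [Fintype.card_embedding_eq, Fintype.card_coe, Fintype.card_fin, h, Nat.descFactorial_self]
  rw [← h1, ← Finset.card_univ]
  symm
  refine Finset.card_bij (fun g _ => g.trans (Function.Embedding.subtype _)) ?_ ?_ ?_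
  · intro g _
    rw [Finset.mem_filter]
    refine ⟨Finset.mem_univ _, Finset.eq_of_subset_of_card_le ?_ ?_⟩
    · intro i hi
      obtain ⟨t, _, rfl⟩ := Finset.mem_map.mp hi
      exact (g t).2
    · rw [Finset.card_map, Finset.card_univ, Fintype.card_fin, h]
  · intro g _ g' _ hgg
    ext t
    exact congrArg Fin.val (DFunLike.congr_fun hgg t)
  · intro f hf
    have hf := (Finset.mem_filter.mp hf).2
    refine ⟨⟨fun t => ⟨f t, hf ▸ Finset.mem_map_of_mem f (Finset.mem_univ t)⟩, fun t t' htt =>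
      f.injective (congrArg Subtype.val htt)⟩, Finset.mem_univ _, ?_⟩
    ext t
    rfl

/-- Group the monomials by their support. A support of size r is enumerated by r! embeddings, whence
the factor 1/r!, and r ≤ d because each exponent is at least 1. The coefficients and the index set
do not depend on `N`, so one expansion serves all partitions at once. -/
theorem eval_poly_eq_sum_augMonomial (d : ℕ) (hd : ∀ N, (F.poly N).totalDegree ≤ d) (N : ℕ)
    (x : Fin N → ℚ) :
    MvPolynomial.eval x (F.poly N) = ∑ r ∈ Finset.range (d + 1),
      ∑ α : Fin r → Fin (d + 1) with ∀ t, α t ≠ 0,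
        ((r ! : ℕ) : ℚ)⁻¹ *
          (F.poly r).coeff (Finsupp.equivFunOnFinite.symm fun t => (α t : ℕ)) *
            augMonomial (fun t => (α t : ℕ)) x := by
  classical
  set G : (Fin N →₀ ℕ) → ℚ := fun s => (F.poly N).coeff s * ∏ i, x i ^ s i with hG
  have hsum : ∀ s ∈ (F.poly N).support, ∑ i ∈ s.support, s i ≤ d := fun s hs =>
    (MvPolynomial.le_totalDegree hs).trans (hd N)
  have hterm : ∀ r, ∀ α : Fin r → Fin (d + 1), ∀ f : Fin r ↪ Fin N,
      G ((Finsupp.equivFunOnFinite.symm fun t => (α t : ℕ)).embDomain f) =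
        (F.poly r).coeff (Finsupp.equivFunOnFinite.symm fun t => (α t : ℕ)) *
          ∏ t, x (f t) ^ (α t : ℕ) := by
    intro r α f
    simp only [hG]
    rw [F.coeff_embDomain]
    congr 1
    rw [← Finset.prod_subset (Finset.subset_univ (Finset.univ.map f)), Finset.prod_map]
    · refine Finset.prod_congr rfl fun t _ => ?_
      rw [Finsupp.embDomain_apply_self]; rfl
    · intro i _ hi
      rw [Finsupp.embDomain_of_notMem_range, pow_zero]
      rintro ⟨t, rfl⟩
      exact hi (Finset.mem_map_of_mem f (Finset.mem_univ t))
  have hfib : ∀ r, ∀ f : Fin r ↪ Fin N,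
      ∑ α : Fin r → Fin (d + 1) with ∀ t, α t ≠ 0,
        G ((Finsupp.equivFunOnFinite.symm fun t => (α t : ℕ)).embDomain f) =
      ∑ s ∈ (F.poly N).support with Finset.univ.map f = s.support, G s := by
    intro r f
    refine Finset.sum_bij_ne_zero (fun α _ _ =>
      (Finsupp.equivFunOnFinite.symm fun t => (α t : ℕ)).embDomain f) ?_ ?_ ?_ ?_
    · intro α hα hne
      rw [Finset.mem_filter] at hα ⊢
      refine ⟨MvPolynomial.mem_support_iff.mpr (left_ne_zero_of_mul hne), ?_⟩
      rw [Finsupp.support_embDomain]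
      congr 1
      ext t
      rw [Finsupp.mem_support_iff]
      exact iff_of_true (Finset.mem_univ t) (fun h => hα.2 t (Fin.ext h))
    · intro α _ _ α' _ _ h
      have h := Finsupp.embDomain_injective f h
      funext t
      exact Fin.ext (DFunLike.congr_fun h t)
    · intro s hs hne
      obtain ⟨hs, hsf⟩ := Finset.mem_filter.mp hs
      have hle : ∀ i, s i < d + 1 := by
        intro i
        by_cases hi : i ∈ s.support
        · exact Nat.lt_succ_of_le
            ((Finset.single_le_sum (fun _ _ => Nat.zero_le _) hi).trans (hsum s hs))
        · rw [Finsupp.notMem_support_iff.mp hi]; exact Nat.succ_pos _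
      have hs' : (Finsupp.equivFunOnFinite.symm fun t => s (f t)).embDomain f = s := by
        ext i
        by_cases hi : i ∈ Set.range f
        · obtain ⟨t, rfl⟩ := hi
          rw [Finsupp.embDomain_apply_self]; rfl
        · rw [Finsupp.embDomain_of_notMem_range _ _ _ hi, eq_comm, ← Finsupp.notMem_support_iff,
            ← hsf]
          intro h
          obtain ⟨t, _, rfl⟩ := Finset.mem_map.mp h
          exact hi ⟨t, rfl⟩
      refine ⟨fun t => ⟨s (f t), hle _⟩, ?_, ?_, hs'⟩
      · rw [Finset.mem_filter]
        refine ⟨Finset.mem_univ _, fun t h => ?_⟩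
        have ht : f t ∈ s.support := hsf ▸ Finset.mem_map_of_mem f (Finset.mem_univ t)
        exact Finsupp.mem_support_iff.mp ht (congrArg Fin.val h)
      · simp only [hs']; exact hne
    · intro α _ _
      rfl
  have hr : ∀ r, ∑ α : Fin r → Fin (d + 1) with ∀ t, α t ≠ 0,
        ((r ! : ℕ) : ℚ)⁻¹ *
          (F.poly r).coeff (Finsupp.equivFunOnFinite.symm fun t => (α t : ℕ)) *
            augMonomial (fun t => (α t : ℕ)) x =
      ∑ s ∈ (F.poly N).support, if s.support.card = r then G s else 0 := by
    intro r
    have h1 : ∀ α : Fin r → Fin (d + 1), ((r ! : ℕ) : ℚ)⁻¹ *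
          (F.poly r).coeff (Finsupp.equivFunOnFinite.symm fun t => (α t : ℕ)) *
            augMonomial (fun t => (α t : ℕ)) x = ((r ! : ℕ) : ℚ)⁻¹ * ∑ f : Fin r ↪ Fin N,
        G ((Finsupp.equivFunOnFinite.symm fun t => (α t : ℕ)).embDomain f) := by
      intro α
      simp only [hterm, ← Finset.mul_sum]
      rw [mul_assoc, augMonomial]
    rw [Finset.sum_congr rfl fun α _ => h1 α, ← Finset.mul_sum, Finset.sum_comm,
      Finset.sum_congr rfl fun f _ => hfib r f]
    simp only [Finset.sum_filter]
    rw [Finset.sum_comm, Finset.mul_sum]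
    refine Finset.sum_congr rfl fun s _ => ?_
    rw [← Finset.sum_filter, Finset.sum_const, nsmul_eq_mul]
    split_ifs with h
    · rw [card_embedding_map_eq _ h, inv_mul_cancel_left₀ (by positivity)]
    · rw [Finset.filter_false_of_mem]
      · simp
      · intro f _ hf
        apply h
        rw [← hf, Finset.card_map, Finset.card_univ, Fintype.card_fin]
  rw [Finset.sum_congr rfl fun r _ => hr r, Finset.sum_comm, MvPolynomial.eval_eq']
  refine Finset.sum_congr rfl fun s hs => ?_
  rw [Finset.sum_ite_eq, if_pos]
  rw [Finset.mem_range, Nat.lt_succ_iff]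
  refine le_trans ?_ (hsum s hs)
  rw [Finset.card_eq_sum_ones]
  exact Finset.sum_le_sum fun i hi => Nat.one_le_iff_ne_zero.mpr (Finsupp.mem_support_iff.mp hi)

end SymmetricFunction

/-! ### Symmetric functions of the contents lie in the filtration -/

namespace StrictPartition

/-- The modified contents of the boxes, enumerated. -/
def contentVec (lam : StrictPartition) (k : Fin lam.diagram.card) : ℚ :=
  contentHat (lam.diagram.equivFin.symm k)

theorem sum_contentVec_pow (lam : StrictPartition) (j : ℕ) :
    ∑ k, contentVec lam k ^ j = contentPowerSum j lam := by
  have h1 : ∑ k, contentVec lam k ^ j = ∑ b ∈ lam.diagram, contentHat b ^ j := by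
    rw [← Finset.sum_coe_sort lam.diagram (fun b => contentHat b ^ j)]
    exact lam.diagram.equivFin.symm.sum_comp (fun b : lam.diagram => contentHat b.1 ^ j)
  rw [h1]
  have h2 := sum_diagram lam (fun c => (1 / 2 * (c : ℚ) * ((c : ℚ) + 1)) ^ j)
  refine h2.trans ?_
  rw [contentPowerSum]
  refine Finset.sum_congr rfl fun a _ => Finset.sum_congr rfl fun c _ => ?_
  rw [chat]
  push_cast
  congr 1
  ring

theorem exists_augMonomial_mem {r : ℕ} (α : Fin r → ℕ) : ∃ d,
    (fun lam : StrictPartition => augMonomial α (contentVec lam)) ∈ contentFiltration d := by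
  induction r with
  | zero =>
    refine ⟨0, ?_⟩
    simp only [augMonomial_zero]
    exact one_mem_contentFiltration 0
  | succ r ih =>
    obtain ⟨d, hd⟩ := ih (fun t => α t.succ)
    choose e he using fun t : Fin r =>
      ih (Function.update (fun t => α t.succ) t (α t.succ + α 0))
    -- A crude common bound: the product has weight at most α 0 + 1 + d, and each merged term has
    -- weight at most e t.
    refine ⟨α 0 + 1 + d + ∑ t, e t, ?_⟩
    have : (fun lam : StrictPartition => augMonomial α (contentVec lam)) =
        contentPowerSum (α 0) *
          (fun lam : StrictPartition => augMonomial (fun t => α t.succ) (contentVec lam)) -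
        ∑ t, fun lam : StrictPartition => augMonomial
          (Function.update (fun t => α t.succ) t (α t.succ + α 0)) (contentVec lam) := by
      funext lam
      rw [augMonomial_succ, sum_contentVec_pow]
      simp
    rw [this]
    refine sub_mem (mul_mem_contentFiltration (contentPowerSum_mem le_rfl) hd (by omega))
      (Submodule.sum_mem _ fun t _ => contentFiltration_mono ?_ (he t))
    exact (Finset.single_le_sum (fun _ _ => Nat.zero_le _) (Finset.mem_univ t)).trans (by omega)

theorem mem_iSup_contentFiltration {f : StrictPartition → ℚ} :
    f ∈ (⨆ d, contentFiltration d) ↔ ∃ d, f ∈ contentFiltration d :=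
  Submodule.mem_iSup_of_directed _ (directed_of_isDirected_le fun _ _ h => contentFiltration_mono h)

theorem exists_evalOn_mem (F : SymmetricFunction) : ∃ d,
    (fun lam : StrictPartition => F.evalOn lam.diagram contentHat) ∈ contentFiltration d := by
  obtain ⟨d, hd⟩ := F.bounded
  have : (fun lam : StrictPartition => F.evalOn lam.diagram contentHat) =
      ∑ r ∈ Finset.range (d + 1), ∑ α : Fin r → Fin (d + 1) with ∀ t, α t ≠ 0,
        (((r ! : ℕ) : ℚ)⁻¹ *
          (F.poly r).coeff (Finsupp.equivFunOnFinite.symm fun t => (α t : ℕ))) •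
            fun lam : StrictPartition => augMonomial (fun t => (α t : ℕ)) (contentVec lam) := by
    funext lam
    simp only [Finset.sum_apply, Pi.smul_apply, smul_eq_mul]
    exact F.eval_poly_eq_sum_augMonomial d hd _ _
  rw [this, ← mem_iSup_contentFiltration]
  exact Submodule.sum_mem _ fun r _ => Submodule.sum_mem _ fun α _ => Submodule.smul_mem _ _
    (mem_iSup_contentFiltration.mpr (exists_augMonomial_mem _))

end StrictPartition

end

theorem corollary1p4 (m : ℕ) (mu : StrictPartition) (hmu : mu.size = m) (F : SymmetricFunction) :
    ∃ P : ℚ[X], ∀ n : ℕ,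
      ∑ lam ∈ StrictPartition.ofSize (n + m),
        (m ! : ℚ) / ((n + m)! : ℚ) * (2 : ℚ) ^ ((n : ℤ) - (lam.length : ℤ) + (mu.length : ℤ)) *
          ((lam.numTableaux : ℚ) / (mu.numTableaux : ℚ)) * (lam.numSkewTableaux mu : ℚ) *
          F.evalOn lam.diagram contentHat = P.eval (n : ℚ) := by
  obtain ⟨d, hd⟩ := StrictPartition.exists_evalOn_mem F
  obtain ⟨P, hP⟩ := StrictPartition.exists_polynomial_pathSum mu d hd
  refine ⟨P, fun n => ?_⟩
  rw [← hP, StrictPartition.pathSum]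
  subst hmu
  refine Finset.sum_congr rfl fun lam hlam => ?_
  rw [StrictPartition.mem_ofSize] at hlam
  -- The product formula cancels both factorials, and the powers of 2 regroup as 2ⁿ times the two
  -- factors 2^{-ℓ} inside `planchWeight`.
  rw [StrictPartition.numSkewTableaux_eq hlam, StrictPartition.numTableaux_eq,
    StrictPartition.numTableaux_eq, hlam, StrictPartition.length_eq_card,
    StrictPartition.length_eq_card, zpow_add₀ two_ne_zero, zpow_sub₀ two_ne_zero, zpow_natCast,
    zpow_natCast, zpow_natCast, StrictPartition.planchWeight, StrictPartition.planchWeight,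
    inv_pow, inv_pow]
  have h1 : ((mu.size ! : ℕ) : ℚ) ≠ 0 := by positivity
  have h2 : (((n + mu.size)! : ℕ) : ℚ) ≠ 0 := by positivity
  have h3 := (hookProd_pos mu.partSet).ne'
  field_simp
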